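/- Let $n \ge 2$ agents $1,\dots,n$ and $m$ items be given, with $m = qn$ for an integer $q \ge 1$. Each agent $i$ has a strict preference order $\pi_i$ over the items, and $\pi_1,\dots,\pi_n$ are sampled independently and uniformly at random from all $m!$ orders. For bundles (sets of items) $A,B$ and an order $\pi$, write $A \succeq^{\mathrm{sd}}_{\pi} B$ if $|A| \ge |B|$ and, for every $k \le |B|$, the $k$-th best item of $A$ is at least as good as the $k$-th best item of $B$ according to $\pi$. An allocation (a partition $(A_1,\dots,A_n)$ of the items) is SD-envy-free (SD-EF) if $A_i \succeq^{\mathrm{sd}}_{\pi_i} A_j$ for all agents $i,j$. Give-Away Round Robin is the following algorithm. Phase 1: for $i = 1,\dots,n$, and for each $j = 1,\dots,n$ with $j \ne i$ in this order, agent $i$'s worst unallocated item (according to $\pi_i$) is given to agent $j$. Phase 2: the agents take turns in the order $1,\dots,n,1,\dots,n,\dots$, each taking her best unallocated item, until all items are allocated. (If the items run out, the remaining steps are void.) Then, for each fixed $n$, the probability that the output of Give-Away Round Robin is an SD-EF allocation is at least $1 - \tilde{O}_n\left(\frac{1}{m}\right)$, that is, there are constants $C$ and $k$ depending only on $n$ such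 that it is at least $1 - C\,\frac{(\log m)^k}{m}$ for all $m = qn$ with $q \ge 1$. Explicitly, with $\log$ the natural logarithm, this probability is at least \[ 1 - \frac{67584\,n^3\log^2 m + 25216\,n^4\log m + 2354\,n^5 + 128\,n^2\log m + 24\,n^3 + 3n^2 + n}{m}. \] -/

import Mathlib

open MeasureTheory

/-- The `m` items are `Fin m`. A strict preference order over the items is a permutation `σ`:
`σ k` is the item in position `k` (position `0` is the best one), and `σ.symm g` is the position,
or index, of item `g`. -/
abbrev PrefOrder (m : ℕ) : Type := Equiv.Perm (Fin m)

/-- The set of positions, in the order `σ`, of the items of the bundle `A`. -/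
def positions {m : ℕ} (σ : PrefOrder m) (A : Finset (Fin m)) : Finset (Fin m) :=
  A.map σ.symm.toEmbedding

theorem positions_nonempty {m : ℕ} (σ : PrefOrder m) {A : Finset (Fin m)} (h : A.Nonempty) :
    (positions σ A).Nonempty := by
  simpa [positions] using h

/-- Stochastic dominance of bundles with respect to `σ`: `A` has at least as many items as `B`,
and for every `k < |B|` the `k`-th smallest position of an item of `A` is at most the `k`-th
smallest position of an item of `B`. -/
def SDPrefers {m : ℕ} (σ : PrefOrder m) (A B : Finset (Fin m)) : Prop :=
  ∃ h : (positions σ B).card ≤ (positions σ A).card,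
    ∀ k : Fin (positions σ B).card,
      (positions σ A).orderEmbOfFin rfl (Fin.castLE h k) ≤ (positions σ B).orderEmbOfFin rfl k

/-- `A` is an allocation: the bundles `A i` are pairwise disjoint and cover all items. -/
def IsAllocation {n m : ℕ} (A : Fin n → Finset (Fin m)) : Prop :=
  (∀ i j, i ≠ j → Disjoint (A i) (A j)) ∧ ∀ g, ∃ i, g ∈ A i

/-- `A` is SD-envy-free for agents with preference orders `π`. -/
def IsSDEF {n m : ℕ} (π : Fin n → PrefOrder m) (A : Fin n → Finset (Fin m)) : Prop :=
  ∀ i j, SDPrefers (π i) (A i) (A j)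

/-- The item of the nonempty pool `P` with the lowest index in `σ` (the best item). -/
def bestItem {m : ℕ} (σ : PrefOrder m) (P : Finset (Fin m)) (h : P.Nonempty) : Fin m :=
  σ ((positions σ P).min' (positions_nonempty σ h))

/-- The item of the nonempty pool `P` with the highest index in `σ` (the worst item). -/
def worstItem {m : ℕ} (σ : PrefOrder m) (P : Finset (Fin m)) (h : P.Nonempty) : Fin m :=
  σ ((positions σ P).max' (positions_nonempty σ h))

/-- The state of the algorithm: the unallocated items and the current bundles. -/
structure AllocState (n m : ℕ) where
  pool : Finset (Fin m)
  bundle : Fin n → Finset (Fin m)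

/-- Move item `g` from the pool to the bundle of agent `j`. -/
def AllocState.assign {n m : ℕ} (s : AllocState n m) (j : Fin n) (g : Fin m) : AllocState n m where
  pool := s.pool.erase g
  bundle := Function.update s.bundle j (insert g (s.bundle j))

/-- Agent `i` gives her worst unallocated item to agent `j` (nothing happens if no item is
left). -/
def giveStep {n m : ℕ} (π : Fin n → PrefOrder m) (s : AllocState n m) (i j : Fin n) :
    AllocState n m :=
  if h : s.pool.Nonempty then s.assign j (worstItem (π i) s.pool h) else s

/-- Agent `i` picks her best unallocated item (nothing happens if no item is left). -/
def pickStep {n m : ℕ} (π : Fin n → PrefOrder m) (s : AllocState n m) (i : Fin n) :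
    AllocState n m :=
  if h : s.pool.Nonempty then s.assign i (bestItem (π i) s.pool h) else s

/-- Phase 1: for each agent `i` in increasing order, and each agent `j ≠ i` in increasing order,
agent `i` gives her worst unallocated item to agent `j`. -/
def giveAwayPhase {n m : ℕ} (π : Fin n → PrefOrder m) (s : AllocState n m) : AllocState n m :=
  (List.finRange n).foldl
    (fun s i => ((List.finRange n).filter (fun j => j ≠ i)).foldl (fun s j => giveStep π s i j) s) s

/-- Phase 2: agents pick their best unallocated items in the cyclic order `1, …, n, 1, …, n, …`
until no item is left; for this `m` rounds suffice, the turns after the last item being void. -/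
def roundRobinPhase {n m : ℕ} (π : Fin n → PrefOrder m) (s : AllocState n m) : AllocState n m :=
  (List.replicate m (List.finRange n)).flatten.foldl (pickStep π) s

/-- The output of Give-Away Round Robin. -/
def giveAwayRoundRobin {n m : ℕ} (π : Fin n → PrefOrder m) : Fin n → Finset (Fin m) :=
  (roundRobinPhase π (giveAwayPhase π ⟨Finset.univ, fun _ => ∅⟩)).bundle

/-- All sets of preference orders are measurable. -/
instance prefOrderMeasurableSpace (m : ℕ) : MeasurableSpace (PrefOrder m) := ⊤

/-- The law of `n` preference orders over `m` items, sampled independently and uniformly. -/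
noncomputable def uniformProfileLaw (n m : ℕ) : Measure (Fin n → PrefOrder m) :=
  Measure.pi fun _ => (PMF.uniformOfFintype (PrefOrder m)).toMeasure

/-- The probability that Give-Away Round Robin outputs an SD-envy-free allocation when the `n`
preference orders over the `m` items are sampled independently and uniformly. -/
noncomputable def giveAwaySuccessProb (n m : ℕ) : ℝ :=
  (uniformProfileLaw n m).real
    {π | IsAllocation (giveAwayRoundRobin π) ∧ IsSDEF π (giveAwayRoundRobin π)}

/-! Fix an agent `i` and let `M = m + 1 - n`. Fewer than `n * n` items are given away before her
giving turn, and they are independent of her order, so her last `n - 1` items are all still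
available then, up to probability `n ^ 3 / m` (`card_not_lastItemsAvailable_le`). In that case every
other agent receives one of these items and agent `i` holds none. Moreover Phase 1 and the picks of
the others do not depend on how her first `M` positions are arranged, so this arrangement can be
revealed gradually. `reveal` replays the algorithm while she inspects her items from best to worst,
and the next item is uniform among the uninspected items of the first `M` positions. Formally,
profiles are counted and sums are averaged over transpositions of positions
(`sum_le_of_swap_average`).

Failure of SD-dominance over `j` means that some prefix of length `t` of her order contains more
items of `j` than of `i`. This forces two things. She misses more than half of the first `t` items
(`lt_two_mul_missed_of_envy`). Also `j` holds fewer uninspected items among the first `M` positions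
than she does (`uninspected_lt_of_envy`): at inspection times `j` is at most one item ahead, and the
item that she gave to `j` out of her last `n - 1` makes up for this lead. Her own uninspected items
are gifts, at most `n - 1` of them.

With `l` of order `log m + n`, the thresholds split into ranges (`envy_cases`). For `t < 6 * l` she
misses one of her first `6 * l` items, which has probability `O(n * l ^ 2 / m)`. For `6 * l ≤ t < 64
* n * l` an exponential moment of the number of misses gives probability at most `2 ^ (-t)`. For `64
* n * l ≤ t ≤ M - 64 * n * l`, agent `j` has received about `t / n` items and yet at most `n` of
them are uninspected; a supermartingale (`sum_survival_le`) makes this very unlikely. For larger `t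
< M` she was given an item in the last `64 * n * l` of her first `M` positions, which has
probability `O(n ^ 2 * l / m)`. For `t ≥ M` her whole bundle is counted, and all bundles have the
same size since `n` divides `m`. A union bound over the agents finishes the proof. -/

/-! ### Stochastic dominance through prefix counts -/

/-- The bundle `A` weakly dominates `B` once every initial segment of the order contains at least
as many items of `A` as of `B`. -/
theorem sdPrefers_of_count {m : ℕ} (σ : PrefOrder m) {A B : Finset (Fin m)} (hc : B.card ≤ A.card)
    (h : ∀ t < m, (B.filter fun g => (σ.symm g : ℕ) < t + 1).card
      ≤ (A.filter fun g => (σ.symm g : ℕ) < t + 1).card) : SDPrefers σ A B := by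
  have key : ∀ (C : Finset (Fin m)) (x : Fin m),
      ((positions σ C).filter fun p => p ≤ x).card
        = (C.filter fun g => (σ.symm g : ℕ) < (x : ℕ) + 1).card := by
    intro C x
    rw [positions, Finset.filter_map, Finset.card_map]
    refine congrArg Finset.card (Finset.filter_congr fun g _ => ?_)
    rw [Function.comp_apply, Equiv.toEmbedding_apply, Fin.le_def]
    exact Nat.lt_succ_iff.symm
  refine ⟨by simpa [positions] using hc, fun k => ?_⟩
  by_contra hlt
  rw [not_le] at hlt
  set x := (positions σ B).orderEmbOfFin rfl k with hx
  have hB : (k : ℕ) + 1 ≤ ((positions σ B).filter fun p => p ≤ x).card := by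
    have : (Finset.univ.filter fun l : Fin (positions σ B).card => l ≤ k).card = (k : ℕ) + 1 := by
      have : (Finset.univ.filter fun l : Fin (positions σ B).card => l ≤ k) = Finset.Iic k := by
        ext; simp
      rw [this, Fin.card_Iic]
    rw [← this]
    refine Finset.card_le_card_of_injOn ((positions σ B).orderEmbOfFin rfl) ?_
      ((positions σ B).orderEmbOfFin rfl).injective.injOn
    intro l hl
    simp only [Finset.coe_filter, Finset.mem_univ, true_and, Set.mem_ofPred_eq] at hl ⊢
    exact ⟨Finset.orderEmbOfFin_mem _ _ _, ((positions σ B).orderEmbOfFin rfl).monotone hl⟩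
  -- The `k`-th position of `A` lies beyond `x`, so only earlier ones, at most `k` of them, can be
  -- at most `x`.
  have hA : ((positions σ A).filter fun p => p ≤ x).card ≤ (k : ℕ) := by
    have hk : (Finset.univ.filter fun l : Fin (positions σ A).card => (l : ℕ) < k).card
        ≤ (k : ℕ) := by
      conv_rhs => rw [← Finset.card_range (k : ℕ)]
      exact Finset.card_le_card_of_injOn Fin.val (by intro l; simp) Fin.val_injective.injOn
    refine le_trans ?_ hk
    have hsub : ((positions σ A).filter fun p => p ≤ x)
        ⊆ (Finset.univ.filter fun l : Fin (positions σ A).card => (l : ℕ) < k).image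
          ((positions σ A).orderEmbOfFin rfl) := by
      intro p hp
      rw [Finset.mem_filter] at hp
      have : p ∈ Set.range ((positions σ A).orderEmbOfFin rfl) := by
        rw [Finset.range_orderEmbOfFin]; exact hp.1
      obtain ⟨l, rfl⟩ := this
      refine Finset.mem_image_of_mem _ (Finset.mem_filter.2 ⟨Finset.mem_univ _, ?_⟩)
      have := ((positions σ A).orderEmbOfFin rfl).lt_iff_lt.1 (lt_of_le_of_lt hp.2 hlt)
      simpa [Fin.lt_def] using this
    exact (Finset.card_le_card hsub).trans Finset.card_image_le
  rw [key] at hA hB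
  have := h x x.2
  omega

/-! ### Probabilities as counts of profiles -/

instance prefOrderMeasurableSingleton (m : ℕ) : MeasurableSingletonClass (PrefOrder m) :=
  ⟨fun _ => trivial⟩

open Classical in
-- All singletons have the same mass under the product law; this turns every later estimate into a
-- count.
theorem uniformProfileLaw_real (n m : ℕ) (S : Set (Fin n → PrefOrder m)) :
    (uniformProfileLaw n m).real S
      = ((Finset.univ.filter fun π => π ∈ S).card : ℝ) / (Fintype.card (Fin n → PrefOrder m) : ℝ) := by
  have hs : ∀ π : Fin n → PrefOrder m, (uniformProfileLaw n m).real {π}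
      = 1 / (Fintype.card (Fin n → PrefOrder m) : ℝ) := by
    intro π
    rw [measureReal_def, uniformProfileLaw, Measure.pi_singleton]
    simp [PMF.uniformOfFintype_apply, ENNReal.toReal_inv]
  have : IsProbabilityMeasure (uniformProfileLaw n m) := by
    unfold uniformProfileLaw; infer_instance
  have hS : S = ((Finset.univ.filter fun π => π ∈ S : Finset (Fin n → PrefOrder m)) : Set _) := by
    ext; simp
  conv_lhs => rw [hS]
  rw [← sum_measureReal_singleton]
  simp only [hs, Finset.sum_const, nsmul_eq_mul]
  ring

/-! ### Transpositions of positions and deferred decisions -/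

/-- The profile `π` with positions `u` and `v` exchanged in the order of agent `i`. -/
def swapAt {n m : ℕ} (i : Fin n) (u v : Fin m) (π : Fin n → PrefOrder m) : Fin n → PrefOrder m :=
  Function.update π i (π i * Equiv.swap u v)

theorem swapAt_self {n m : ℕ} (i : Fin n) (u v : Fin m) (π : Fin n → PrefOrder m) :
    swapAt i u v π i = π i * Equiv.swap u v := by
  simp [swapAt]

theorem swapAt_of_ne {n m : ℕ} {i j : Fin n} (h : j ≠ i) (u v : Fin m) (π : Fin n → PrefOrder m) :
    swapAt i u v π j = π j := by
  simp [swapAt, h]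

theorem swapAt_swapAt {n m : ℕ} (i : Fin n) (u v : Fin m) (π : Fin n → PrefOrder m) :
    swapAt i u v (swapAt i u v π) = π := by
  simp [swapAt, mul_assoc]

theorem swapAt_symm_apply {n m : ℕ} (i : Fin n) (u v : Fin m) (π : Fin n → PrefOrder m)
    (g : Fin m) : (swapAt i u v π i).symm g = Equiv.swap u v ((π i).symm g) := by
  rw [swapAt_self]
  simp [Equiv.Perm.mul_def]

theorem swapAt_apply_left {n m : ℕ} (i : Fin n) (u v : Fin m) (π : Fin n → PrefOrder m) :
    swapAt i u v π i u = π i v := by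
  simp [swapAt_self]

theorem swapAt_apply_of_ne {n m : ℕ} (i : Fin n) (u v k : Fin m) (π : Fin n → PrefOrder m)
    (hu : k ≠ u) (hv : k ≠ v) : swapAt i u v π i k = π i k := by
  simp [swapAt_self, Equiv.swap_apply_of_ne_of_ne hu hv]

/-- The positions `k` with `t ≤ k < M`. -/
def window (m t M : ℕ) : Finset (Fin m) :=
  Finset.univ.filter fun k => t ≤ (k : ℕ) ∧ (k : ℕ) < M

theorem mem_window {m t M : ℕ} {k : Fin m} : k ∈ window m t M ↔ t ≤ (k : ℕ) ∧ (k : ℕ) < M := by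
  simp [window]

theorem card_window {m t M : ℕ} (h : M ≤ m) : (window m t M).card = M - t := by
  have : (window m t M).map Fin.valEmbedding = Finset.Ico t M := by
    ext k
    simp only [Finset.mem_map, mem_window, Fin.valEmbedding_apply, Finset.mem_Ico]
    constructor
    · rintro ⟨k, hk, rfl⟩; exact hk
    · intro hk; exact ⟨⟨k, by omega⟩, hk, rfl⟩
  rw [← Finset.card_map, this, Nat.card_Ico]

/-- The items that `σ` puts into positions `k` with `t ≤ k < M`. -/
def itemsIn {m : ℕ} (σ : PrefOrder m) (t M : ℕ) : Finset (Fin m) :=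
  Finset.univ.filter fun g => t ≤ (σ.symm g : ℕ) ∧ (σ.symm g : ℕ) < M

theorem mem_itemsIn {m : ℕ} {σ : PrefOrder m} {t M : ℕ} {g : Fin m} :
    g ∈ itemsIn σ t M ↔ t ≤ (σ.symm g : ℕ) ∧ (σ.symm g : ℕ) < M := by
  simp [itemsIn]

theorem itemsIn_eq_map {m : ℕ} (σ : PrefOrder m) (t M : ℕ) :
    itemsIn σ t M = (window m t M).map σ.toEmbedding := by
  ext g
  simp only [mem_itemsIn, Finset.mem_map, mem_window, Equiv.coe_toEmbedding]
  constructor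
  · intro h; exact ⟨σ.symm g, h, by simp⟩
  · rintro ⟨k, h, rfl⟩; simpa using h

theorem card_itemsIn {m : ℕ} (σ : PrefOrder m) {t M : ℕ} (h : M ≤ m) :
    (itemsIn σ t M).card = M - t := by
  rw [itemsIn_eq_map, Finset.card_map, card_window h]

/-- A family of profiles closed under permuting the first `M` positions of agent `i`. -/
def SwapClosed {n m : ℕ} (i : Fin n) (M : ℕ) (D : Finset (Fin n → PrefOrder m)) : Prop :=
  ∀ π ∈ D, ∀ u v : Fin m, (u : ℕ) < M → (v : ℕ) < M → swapAt i u v π ∈ D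

/-- Deferred decisions: the item in position `p` may be averaged over all positions of a window
that contains `p`. -/
theorem sum_swap_average {n m : ℕ} {i : Fin n} {M t : ℕ} (hM : M ≤ m)
    {D : Finset (Fin n → PrefOrder m)} (hD : SwapClosed i M D) {p : Fin m} (hp : (p : ℕ) < M)
    (H : (Fin n → PrefOrder m) → ℝ) :
    ((M - t : ℕ) : ℝ) * ∑ π ∈ D, H π
      = ∑ π ∈ D, ∑ u ∈ window m t M, H (swapAt i p u π) := by
  rw [Finset.sum_comm]
  -- For fixed `u` the exchange is an involution of `D`, so every `u` in the window contributes the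
  -- full sum.
  have : ∀ u ∈ window m t M, ∑ π ∈ D, H (swapAt i p u π) = ∑ π ∈ D, H π := by
    intro u hu
    rw [mem_window] at hu
    refine Finset.sum_bij' (fun π _ => swapAt i p u π) (fun π _ => swapAt i p u π) ?_ ?_ ?_ ?_ ?_
    · intro π hπ; exact hD π hπ p u hp hu.2
    · intro π hπ; exact hD π hπ p u hp hu.2
    · intro π _; exact swapAt_swapAt i p u π
    · intro π _; exact swapAt_swapAt i p u π
    · intro π _; rfl
  rw [Finset.sum_congr rfl this, Finset.sum_const, card_window hM, nsmul_eq_mul]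

/-- If each profile averages to at most `c` times `G` over the possible items in position `t`, then
the sum of `H` is at most `c` times that of `G`. -/
theorem sum_le_of_swap_average {n m : ℕ} {i : Fin n} {M : ℕ} (hM : M ≤ m)
    {D : Finset (Fin n → PrefOrder m)} (hD : SwapClosed i M D) (p : Fin m) (hp : (p : ℕ) < M)
    (H G : (Fin n → PrefOrder m) → ℝ) (c : ℝ)
    (h : ∀ π ∈ D, ∑ u ∈ window m p M, H (swapAt i p u π) ≤ ((M - p : ℕ) : ℝ) * (c * G π)) :
    ∑ π ∈ D, H π ≤ c * ∑ π ∈ D, G π := by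
  have h1 := sum_swap_average (t := p) hM hD hp H
  have h2 := Finset.sum_le_sum h
  rw [← h1, ← Finset.mul_sum, ← Finset.mul_sum] at h2
  have hpos : (0 : ℝ) < ((M - p : ℕ) : ℝ) := by
    exact_mod_cast Nat.sub_pos_of_lt hp
  exact le_of_mul_le_mul_left h2 hpos

/-! ### Sequences of moves: partition, pool and bundle sizes -/

/-- The bundles and the pool form a partition of the items. -/
structure AllocState.Valid {n m : ℕ} (s : AllocState n m) : Prop where
  disjoint : ∀ i j, i ≠ j → Disjoint (s.bundle i) (s.bundle j)
  disjoint_pool : ∀ i, Disjoint s.pool (s.bundle i)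
  cover : ∀ g, g ∈ s.pool ∨ ∃ i, g ∈ s.bundle i

/-- `s'` arises from `s` by moving some item of the pool to agent `j`, or the pool is empty and
nothing happens. -/
def IsMove {n m : ℕ} (s : AllocState n m) (j : Fin n) (s' : AllocState n m) : Prop :=
  (∃ g ∈ s.pool, s' = s.assign j g) ∨ (s.pool = ∅ ∧ s' = s)

/-- `s'` arises from `s` by successive moves to the agents of a list. -/
inductive Moves {n m : ℕ} : List (Fin n) → AllocState n m → AllocState n m → Prop
  | nil (s : AllocState n m) : Moves [] s s
  | cons {j : Fin n} {l : List (Fin n)} {s s' s'' : AllocState n m} :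
      IsMove s j s' → Moves l s' s'' → Moves (j :: l) s s''

theorem AllocState.Valid.assign {n m : ℕ} {s : AllocState n m} (hs : s.Valid) (j : Fin n) {g : Fin m}
    (hg : g ∈ s.pool) : (s.assign j g).Valid := by
  have hng : ∀ i, g ∉ s.bundle i := fun i hi => Finset.disjoint_left.1 (hs.disjoint_pool i) hg hi
  refine ⟨fun a b hab => ?_, fun a => ?_, fun x => ?_⟩
  · by_cases ha : a = j
    · subst ha
      have hb : b ≠ a := fun h => hab h.symm
      simp [AllocState.assign, hb, hng, hs.disjoint _ _ hab]
    · by_cases hb : b = j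
      · subst hb
        simp [AllocState.assign, ha, hng, hs.disjoint _ _ hab]
      · simp [AllocState.assign, ha, hb, hs.disjoint _ _ hab]
  · by_cases ha : a = j
    · subst ha
      simp only [AllocState.assign, Function.update_self, Finset.disjoint_insert_right,
        Finset.notMem_erase, not_false_eq_true, true_and]
      exact (hs.disjoint_pool a).mono_left (Finset.erase_subset _ _)
    · simp only [AllocState.assign, ne_eq, ha, not_false_eq_true, Function.update_of_ne]
      exact (hs.disjoint_pool a).mono_left (Finset.erase_subset _ _)
  · by_cases hx : x = g
    · exact Or.inr ⟨j, by simp [AllocState.assign, hx]⟩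
    · rcases hs.cover x with h | ⟨i, hi⟩
      · exact Or.inl (by simp [AllocState.assign, hx, h])
      · refine Or.inr ⟨i, ?_⟩
        by_cases hij : i = j
        · subst hij; simp [AllocState.assign, hi]
        · simp [AllocState.assign, hij, hi]

theorem assign_bundle_card {n m : ℕ} {s : AllocState n m} (hs : s.Valid) (j k : Fin n) {g : Fin m}
    (hg : g ∈ s.pool) :
    ((s.assign j g).bundle k).card = (s.bundle k).card + if j = k then 1 else 0 := by
  have hng : g ∉ s.bundle k := fun hi => Finset.disjoint_left.1 (hs.disjoint_pool k) hg hi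
  by_cases h : j = k
  · subst h; simp [AllocState.assign, hng]
  · have h' : k ≠ j := fun e => h e.symm
    simp [AllocState.assign, h, h']

namespace Moves

variable {n m : ℕ}

theorem append {l₁ l₂ : List (Fin n)} {s s' s'' : AllocState n m} (h₁ : Moves l₁ s s')
    (h₂ : Moves l₂ s' s'') : Moves (l₁ ++ l₂) s s'' := by
  induction h₁ with
  | nil s => exact h₂
  | cons h _ ih => exact Moves.cons h (ih h₂)

theorem valid {l : List (Fin n)} {s s' : AllocState n m} (h : Moves l s s') (hs : s.Valid) :
    s'.Valid := by
  induction h with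
  | nil s => exact hs
  | cons h _ ih =>
    rcases h with ⟨g, hg, rfl⟩ | ⟨_, rfl⟩
    · exact ih (hs.assign _ hg)
    · exact ih hs

theorem pool_subset {l : List (Fin n)} {s s' : AllocState n m} (h : Moves l s s') :
    s'.pool ⊆ s.pool := by
  induction h with
  | nil s => exact subset_rfl
  | cons h _ ih =>
    rcases h with ⟨g, hg, rfl⟩ | ⟨_, rfl⟩
    · exact ih.trans (Finset.erase_subset _ _)
    · exact ih

theorem card_pool_le {l : List (Fin n)} {s s' : AllocState n m} (h : Moves l s s') :
    s.pool.card ≤ s'.pool.card + l.length := by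
  induction h with
  | nil s => simp
  | cons h _ ih =>
    rw [List.length_cons]
    rcases h with ⟨g, hg, rfl⟩ | ⟨_, rfl⟩
    · simp only [AllocState.assign, Finset.card_erase_of_mem hg] at ih
      omega
    · omega

theorem bundle_subset {l : List (Fin n)} {s s' : AllocState n m} (h : Moves l s s') (j : Fin n) :
    s.bundle j ⊆ s'.bundle j := by
  induction h with
  | nil s => exact subset_rfl
  | @cons k l s s' s'' h _ ih =>
    rcases h with ⟨g, hg, rfl⟩ | ⟨_, rfl⟩
    · refine subset_trans ?_ ih
      by_cases hj : j = k
      · subst hj; simp [AllocState.assign]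
      · simp [AllocState.assign, hj]
    · exact ih

theorem mem_of_mem_bundle {l : List (Fin n)} {s s' : AllocState n m} (h : Moves l s s')
    {j : Fin n} {g : Fin m} (hg : g ∈ s'.bundle j) :
    g ∈ s.bundle j ∨ (g ∈ s.pool ∧ j ∈ l) := by
  induction h with
  | nil s => exact Or.inl hg
  | @cons k l s s' s'' h _ ih =>
    rcases h with ⟨x, hx, rfl⟩ | ⟨_, rfl⟩
    · rcases ih hg with h1 | ⟨h1, h2⟩
      · by_cases hj : j = k
        · subst hj
          simp only [AllocState.assign, Function.update_self, Finset.mem_insert] at h1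
          rcases h1 with rfl | h1
          · exact Or.inr ⟨hx, by simp⟩
          · exact Or.inl h1
        · simp only [AllocState.assign, ne_eq, hj, not_false_eq_true, Function.update_of_ne] at h1
          exact Or.inl h1
      · exact Or.inr ⟨Finset.mem_of_mem_erase h1, List.mem_cons_of_mem _ h2⟩
    · rcases ih hg with h1 | ⟨h1, h2⟩
      · exact Or.inl h1
      · exact Or.inr ⟨h1, List.mem_cons_of_mem _ h2⟩

theorem bundle_eq_of_notMem {l : List (Fin n)} {s s' : AllocState n m} (h : Moves l s s')
    {j : Fin n} (hj : j ∉ l) : s'.bundle j = s.bundle j := by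
  refine subset_antisymm (fun g hg => ?_) (h.bundle_subset j)
  exact (h.mem_of_mem_bundle hg).resolve_right fun h => hj h.2

theorem eq_of_pool_empty {l : List (Fin n)} {s s' : AllocState n m} (h : Moves l s s')
    (hs : s.pool = ∅) : s' = s := by
  induction h with
  | nil s => rfl
  | cons h _ ih =>
    rcases h with ⟨x, hx, rfl⟩ | ⟨_, rfl⟩
    · simp [hs] at hx
    · exact ih hs

theorem card_bundle_le {l : List (Fin n)} {s s' : AllocState n m} (h : Moves l s s')
    (hs : s.Valid) (j : Fin n) : (s'.bundle j).card ≤ (s.bundle j).card + l.count j := by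
  induction h with
  | nil s => simp
  | @cons k l s s' s'' h _ ih =>
    rw [List.count_cons]
    rcases h with ⟨x, hx, rfl⟩ | ⟨_, rfl⟩
    · have := ih (hs.assign k hx)
      rw [assign_bundle_card hs k j hx] at this
      simp only [beq_iff_eq]
      omega
    · exact (ih hs).trans (by omega)

/-- A nonempty final pool means that no move was void, so every turn of `j` in the list brings an
item. -/
theorem card_bundle_eq {l : List (Fin n)} {s s' : AllocState n m} (h : Moves l s s')
    (hs : s.Valid) (hp : s'.pool.Nonempty) (j : Fin n) :
    (s'.bundle j).card = (s.bundle j).card + l.count j := by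
  induction h with
  | nil s => simp
  | @cons k l s s' s'' h hl ih =>
    rw [List.count_cons]
    rcases h with ⟨x, hx, rfl⟩ | ⟨he, rfl⟩
    · rw [ih (hs.assign k hx) hp, assign_bundle_card hs k j hx]
      simp only [beq_iff_eq]
      omega
    · exact absurd (hp.mono hl.pool_subset) (by simp [he])

/-- Under moves to distinct agents each bundle gains at most one item. -/
theorem bundle_eq_or_insert {l : List (Fin n)} {s s' : AllocState n m} (h : Moves l s s')
    (hl : l.Nodup) (j : Fin n) :
    s'.bundle j = s.bundle j ∨ ∃ x ∈ s.pool, s'.bundle j = insert x (s.bundle j) := by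
  induction h with
  | nil s => exact Or.inl rfl
  | @cons k l s s' s'' h hm ih =>
    rw [List.nodup_cons] at hl
    rcases h with ⟨x, hx, rfl⟩ | ⟨he, rfl⟩
    · by_cases hj : j = k
      · subst hj
        refine Or.inr ⟨x, hx, ?_⟩
        rw [hm.bundle_eq_of_notMem hl.1]
        simp [AllocState.assign]
      · rcases ih hl.2 with h1 | ⟨y, hy, h1⟩
        · left; rw [h1]; simp [AllocState.assign, hj]
        · right
          refine ⟨y, Finset.mem_of_mem_erase hy, ?_⟩
          rw [h1]; simp [AllocState.assign, hj]
    · exact ih hl.2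

theorem foldl {f : AllocState n m → Fin n → AllocState n m} (hf : ∀ s j, IsMove s j (f s j))
    (l : List (Fin n)) (s : AllocState n m) : Moves l s (l.foldl f s) := by
  induction l generalizing s with
  | nil => exact Moves.nil s
  | cons a l ih => exact Moves.cons (hf s a) (ih _)

end Moves

/-! ### Picking, giving, and the giving turn of one agent -/

theorem worstItem_mem {m : ℕ} (σ : PrefOrder m) (P : Finset (Fin m)) (h : P.Nonempty) :
    worstItem σ P h ∈ P := by
  have := Finset.max'_mem (positions σ P) (positions_nonempty σ h)
  obtain ⟨g, hg, he⟩ := Finset.mem_map.1 this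
  have h2 : worstItem σ P h = g := by
    rw [worstItem, ← he]; simp
  rwa [h2]

theorem bestItem_mem {m : ℕ} (σ : PrefOrder m) (P : Finset (Fin m)) (h : P.Nonempty) :
    bestItem σ P h ∈ P := by
  have := Finset.min'_mem (positions σ P) (positions_nonempty σ h)
  obtain ⟨g, hg, he⟩ := Finset.mem_map.1 this
  have h2 : bestItem σ P h = g := by
    rw [bestItem, ← he]; simp
  rwa [h2]

theorem worstItem_eq {m : ℕ} (σ : PrefOrder m) (P : Finset (Fin m)) (h : P.Nonempty) {g : Fin m}
    (hg : g ∈ P) (hmax : ∀ x ∈ P, σ.symm x ≤ σ.symm g) : worstItem σ P h = g := by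
  have : (positions σ P).max' (positions_nonempty σ h) = σ.symm g := by
    refine le_antisymm (Finset.max'_le _ _ _ fun y hy => ?_) (Finset.le_max' _ _ ?_)
    · rw [positions, Finset.mem_map] at hy
      obtain ⟨x, hx, rfl⟩ := hy
      exact hmax x hx
    · exact Finset.mem_map_of_mem _ hg
  rw [worstItem, this, Equiv.apply_symm_apply]

theorem bestItem_eq {m : ℕ} (σ : PrefOrder m) (P : Finset (Fin m)) (h : P.Nonempty) {g : Fin m}
    (hg : g ∈ P) (hmin : ∀ x ∈ P, σ.symm g ≤ σ.symm x) : bestItem σ P h = g := by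
  have : (positions σ P).min' (positions_nonempty σ h) = σ.symm g := by
    refine le_antisymm (Finset.min'_le _ _ ?_) (Finset.le_min' _ _ _ fun y hy => ?_)
    · exact Finset.mem_map_of_mem _ hg
    · rw [positions, Finset.mem_map] at hy
      obtain ⟨x, hx, rfl⟩ := hy
      exact hmin x hx
  rw [bestItem, this, Equiv.apply_symm_apply]

theorem isMove_giveStep {n m : ℕ} (π : Fin n → PrefOrder m) (i : Fin n) (s : AllocState n m)
    (j : Fin n) : IsMove s j (giveStep π s i j) := by
  unfold giveStep
  split_ifs with h
  · exact Or.inl ⟨_, worstItem_mem _ _ h, rfl⟩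
  · exact Or.inr ⟨Finset.not_nonempty_iff_eq_empty.1 h, rfl⟩

theorem isMove_pickStep {n m : ℕ} (π : Fin n → PrefOrder m) (s : AllocState n m)
    (j : Fin n) : IsMove s j (pickStep π s j) := by
  unfold pickStep
  split_ifs with h
  · exact Or.inl ⟨_, bestItem_mem _ _ h, rfl⟩
  · exact Or.inr ⟨Finset.not_nonempty_iff_eq_empty.1 h, rfl⟩

/-- The recipients of the items that agent `i` gives away. -/
def recipients {n : ℕ} (i : Fin n) : List (Fin n) := (List.finRange n).filter fun j => j ≠ i

theorem nodup_recipients {n : ℕ} (i : Fin n) : (recipients i).Nodup :=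
  (List.nodup_finRange n).filter _

theorem mem_recipients {n : ℕ} {i j : Fin n} : j ∈ recipients i ↔ j ≠ i := by
  simp [recipients]

theorem length_recipients {n : ℕ} (i : Fin n) : (recipients i).length = n - 1 := by
  rw [← List.toFinset_card_of_nodup (nodup_recipients i)]
  have : (recipients i).toFinset = Finset.univ.erase i := by
    ext j; simp [mem_recipients]
  rw [this, Finset.card_erase_of_mem (Finset.mem_univ _), Finset.card_univ, Fintype.card_fin]

theorem count_recipients {n : ℕ} (i j : Fin n) :
    (recipients i).count j = if j = i then 0 else 1 := by
  rw [List.Nodup.count (nodup_recipients i)]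
  by_cases h : j = i <;> simp [mem_recipients, h]

/-- Agent `i` gives away items to all other agents. -/
def giveTurn {n m : ℕ} (π : Fin n → PrefOrder m) (s : AllocState n m) (i : Fin n) :
    AllocState n m :=
  (recipients i).foldl (fun s j => giveStep π s i j) s

theorem giveAwayPhase_eq {n m : ℕ} (π : Fin n → PrefOrder m) (s : AllocState n m) :
    giveAwayPhase π s = (List.finRange n).foldl (giveTurn π) s := rfl

theorem moves_giveTurn {n m : ℕ} (π : Fin n → PrefOrder m) (s : AllocState n m) (i : Fin n) :
    Moves (recipients i) s (giveTurn π s i) :=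
  Moves.foldl (isMove_giveStep π i) _ _

theorem moves_giveTurns {n m : ℕ} (π : Fin n → PrefOrder m) (l : List (Fin n))
    (s : AllocState n m) : Moves (l.flatMap recipients) s (l.foldl (giveTurn π) s) := by
  induction l generalizing s with
  | nil => exact Moves.nil s
  | cons a l ih =>
    rw [List.flatMap_cons]
    exact (moves_giveTurn π s a).append (ih _)

theorem length_flatMap_recipients {n : ℕ} (l : List (Fin n)) :
    (l.flatMap recipients).length = l.length * (n - 1) := by
  induction l with
  | nil => simp
  | cons a l ih =>
    rw [List.flatMap_cons, List.length_append, ih, length_recipients, List.length_cons]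
    ring

/-- Each giver in the list supplies `j` once, unless the giver is `j`. -/
theorem count_flatMap_recipients {n : ℕ} (l : List (Fin n)) (j : Fin n) :
    (l.flatMap recipients).count j + l.count j = l.length := by
  induction l with
  | nil => simp
  | cons a l ih =>
    rw [List.flatMap_cons, List.count_append, count_recipients, List.count_cons, List.length_cons]
    by_cases h : j = a
    · subst h; simp; omega
    · have : a ≠ j := fun e => h e.symm
      simp [h, this]; omega

theorem giveTurn_congr {n m : ℕ} {π π' : Fin n → PrefOrder m} {i : Fin n} (h : π i = π' i)
    (s : AllocState n m) : giveTurn π s i = giveTurn π' s i := by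
  unfold giveTurn giveStep
  rw [h]

theorem foldl_giveTurn_congr {n m : ℕ} {π π' : Fin n → PrefOrder m} {l : List (Fin n)}
    (h : ∀ i ∈ l, π i = π' i) (s : AllocState n m) :
    l.foldl (giveTurn π) s = l.foldl (giveTurn π') s :=
  List.foldl_ext _ _ _ fun s i hi => giveTurn_congr (h i hi) s

theorem foldl_pickStep_congr {n m : ℕ} {π π' : Fin n → PrefOrder m} {l : List (Fin n)}
    (h : ∀ i ∈ l, π i = π' i) (s : AllocState n m) :
    l.foldl (pickStep π) s = l.foldl (pickStep π') s := by
  refine List.foldl_ext _ _ _ fun s i hi => ?_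
  unfold pickStep
  rw [h i hi]

/-- If the last `l.length` positions below `c` are all available to agent `i` and nothing worse is,
then giving away items to the agents in `l` clears exactly these positions. -/
theorem foldl_giveStep_spec {n m : ℕ} (π : Fin n → PrefOrder m) (i : Fin n) (l : List (Fin n))
    (s : AllocState n m) (c : ℕ) (hl : l.length ≤ c) (hc : c ≤ m)
    (hlt : ∀ g ∈ s.pool, ((π i).symm g : ℕ) < c)
    (hmem : ∀ k : Fin m, c - l.length ≤ (k : ℕ) → (k : ℕ) < c → π i k ∈ s.pool) :
    (∀ g ∈ (l.foldl (fun s j => giveStep π s i j) s).pool, ((π i).symm g : ℕ) < c - l.length) ∧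
    (∀ j ∈ l, ∃ g ∈ (l.foldl (fun s j => giveStep π s i j) s).bundle j,
      c - l.length ≤ ((π i).symm g : ℕ)) ∧
    (∀ π' : Fin n → PrefOrder m, (∀ k : Fin m, c - l.length ≤ (k : ℕ) → π' i k = π i k) →
      l.foldl (fun s j => giveStep π' s i j) s = l.foldl (fun s j => giveStep π s i j) s) := by
  induction l generalizing s c with
  | nil => simpa using hlt
  | cons a l ih =>
    rw [List.length_cons] at hl hmem
    have hcm : c - 1 < m := by omega
    set k : Fin m := ⟨c - 1, hcm⟩ with hk
    have hkp : π i k ∈ s.pool := hmem k (by simp [hk]; omega) (by simp [hk]; omega)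
    have hne : s.pool.Nonempty := ⟨_, hkp⟩
    have hw : worstItem (π i) s.pool hne = π i k := by
      refine worstItem_eq _ _ _ hkp fun x hx => ?_
      have := hlt x hx
      rw [Equiv.symm_apply_apply, Fin.le_def]
      simp only [hk]; omega
    have hstep : giveStep π s i a = s.assign a (π i k) := by
      rw [giveStep, dif_pos hne, hw]
    have hpool : (s.assign a (π i k)).pool = s.pool.erase (π i k) := rfl
    obtain ⟨h1, h2, h3⟩ := ih (s.assign a (π i k)) (c - 1) (by omega) (by omega)
      (by
        intro g hg
        rw [hpool, Finset.mem_erase] at hg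
        have h4 := hlt g hg.2
        have h5 : (π i).symm g ≠ k := fun e => hg.1 (by rw [← e]; simp)
        have h6 : ((π i).symm g : ℕ) ≠ c - 1 := fun e => h5 (Fin.ext e)
        omega)
      (by
        intro k' h4 h5
        rw [hpool, Finset.mem_erase]
        refine ⟨fun e => ?_, hmem k' (by omega) (by omega)⟩
        have := (π i).injective e
        rw [this] at h5
        simp [hk] at h5)
    have hcl : c - (a :: l).length = c - 1 - l.length := by
      rw [List.length_cons]; omega
    rw [hcl, List.foldl_cons, hstep]
    refine ⟨h1, ?_, ?_⟩
    · intro j hj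
      rw [List.mem_cons] at hj
      rcases hj with rfl | hj
      · refine ⟨π i k, (Moves.foldl (isMove_giveStep π i) l _).bundle_subset j ?_, ?_⟩
        · simp [AllocState.assign]
        · simp [hk]
      · exact h2 j hj
    · intro π' hπ'
      have hstep' : giveStep π' s i a = s.assign a (π i k) := by
        have hkk : π' i k = π i k := hπ' k (by simp [hk])
        rw [giveStep, dif_pos hne]
        congr 1
        refine worstItem_eq _ _ _ hkp fun x hx => ?_
        -- An item worse than position `k` under `π' i` sits at a position at least `c`, where both
        -- orders agree; so it sits there under `π i` too, against `hlt`.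
        by_contra hlt'
        rw [not_le, ← hkk, Equiv.symm_apply_apply, Fin.lt_def] at hlt'
        simp only [hk] at hlt'
        have h4 := hπ' ((π' i).symm x) (by omega)
        rw [Equiv.apply_symm_apply] at h4
        have h5 := hlt x hx
        rw [h4, Equiv.symm_apply_apply] at h5
        omega
      rw [List.foldl_cons, hstep']
      exact h3 π' hπ'

/-! ### The algorithm seen from agent `i`: inspection of her items in order -/

/-- The agents who precede agent `i` in a round. -/
def agentsBefore {n : ℕ} (i : Fin n) : List (Fin n) := (List.finRange n).take i

/-- The agents who follow agent `i` in a round. -/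
def agentsAfter {n : ℕ} (i : Fin n) : List (Fin n) := (List.finRange n).drop (i + 1)

theorem finRange_eq_append {n : ℕ} (i : Fin n) :
    List.finRange n = agentsBefore i ++ i :: agentsAfter i := by
  have h : (i : ℕ) < (List.finRange n).length := by simp
  have h2 : (List.finRange n)[(i : ℕ)] = i := by simp
  conv_lhs => rw [← List.take_append_drop (i : ℕ) (List.finRange n), List.drop_eq_getElem_cons h, h2]
  rfl

theorem nodup_agents {n : ℕ} (i : Fin n) :
    (i :: (agentsAfter i ++ agentsBefore i)).Nodup := by
  have h := List.nodup_finRange n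
  rw [finRange_eq_append i] at h
  have h2 := List.nodup_append_comm.1 h
  simpa using h2

theorem mem_agents {n : ℕ} (i j : Fin n) : j ∈ i :: (agentsAfter i ++ agentsBefore i) := by
  have h := List.mem_finRange j
  rw [finRange_eq_append i] at h
  simp only [List.mem_append, List.mem_cons] at h ⊢
  tauto

theorem count_agents {n : ℕ} (i j : Fin n) :
    (i :: (agentsAfter i ++ agentsBefore i)).count j = 1 :=
  List.count_eq_one_of_mem (nodup_agents i) (mem_agents i j)

theorem length_agents {n : ℕ} (i : Fin n) :
    (i :: (agentsAfter i ++ agentsBefore i)).length = n := by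
  have h := congrArg List.length (finRange_eq_append i)
  simp only [List.length_finRange, List.length_append, List.length_cons] at h ⊢
  omega

theorem notMem_others {n : ℕ} (i : Fin n) : i ∉ agentsAfter i ++ agentsBefore i :=
  (List.nodup_cons.1 (nodup_agents i)).1

theorem notMem_agentsBefore {n : ℕ} (i : Fin n) : i ∉ agentsBefore i := fun h =>
  notMem_others i (List.mem_append_right _ h)

theorem notMem_agentsAfter {n : ℕ} (i : Fin n) : i ∉ agentsAfter i := fun h =>
  notMem_others i (List.mem_append_left _ h)

theorem ne_of_mem_others {n : ℕ} {i j : Fin n} (h : j ∈ agentsAfter i ++ agentsBefore i) :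
    j ≠ i := fun e => notMem_others i (e ▸ h)

theorem length_agentsBefore {n : ℕ} (i : Fin n) : (agentsBefore i).length = i := by
  simp [agentsBefore]

/-- The initial state: no item is allocated. -/
def initState (n m : ℕ) : AllocState n m := ⟨Finset.univ, fun _ => ∅⟩

theorem initState_valid (n m : ℕ) : (initState n m).Valid :=
  ⟨by simp [initState], by simp [initState], by simp [initState]⟩

/-- The state in which agent `i` makes her first pick. -/
def startState {n m : ℕ} (π : Fin n → PrefOrder m) (i : Fin n) : AllocState n m :=
  (agentsBefore i).foldl (pickStep π) (giveAwayPhase π (initState n m))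

/-- The picks of all other agents between two picks of agent `i`. -/
def otherPicks {n m : ℕ} (π : Fin n → PrefOrder m) (i : Fin n) (s : AllocState n m) :
    AllocState n m :=
  (agentsAfter i ++ agentsBefore i).foldl (pickStep π) s

/-- Agent `i` inspects the item `g`: she picks it if it is available, and then the other agents
pick. -/
def revealStep {n m : ℕ} (π : Fin n → PrefOrder m) (i : Fin n) (s : AllocState n m) (g : Fin m) :
    AllocState n m :=
  if g ∈ s.pool then otherPicks π i (s.assign i g) else s

/-- The state after agent `i` has inspected the first `t` items of her order. -/
def reveal {n m : ℕ} (π : Fin n → PrefOrder m) (i : Fin n) : ℕ → AllocState n m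
  | 0 => startState π i
  | t + 1 => if h : t < m then revealStep π i (reveal π i t) (π i ⟨t, h⟩) else reveal π i t

section

variable {n m : ℕ} (π : Fin n → PrefOrder m) (i : Fin n)

theorem reveal_succ {t : ℕ} (h : t < m) :
    reveal π i (t + 1) = revealStep π i (reveal π i t) (π i ⟨t, h⟩) := by
  rw [reveal, dif_pos h]

theorem moves_giveAwayPhase (s : AllocState n m) :
    Moves ((List.finRange n).flatMap recipients) s (giveAwayPhase π s) :=
  moves_giveTurns π _ s

theorem moves_startState :
    Moves (agentsBefore i) (giveAwayPhase π (initState n m)) (startState π i) :=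
  Moves.foldl (isMove_pickStep π) _ _

theorem moves_otherPicks (s : AllocState n m) :
    Moves (agentsAfter i ++ agentsBefore i) s (otherPicks π i s) :=
  Moves.foldl (isMove_pickStep π) _ _

variable {π i} in
theorem moves_revealStep {s : AllocState n m} {g : Fin m} (hg : g ∈ s.pool) :
    Moves (i :: (agentsAfter i ++ agentsBefore i)) s (revealStep π i s g) := by
  rw [revealStep, if_pos hg]
  exact Moves.cons (Or.inl ⟨g, hg, rfl⟩) (moves_otherPicks π i _)

variable {π i} in
theorem revealStep_of_notMem {s : AllocState n m} {g : Fin m} (hg : g ∉ s.pool) :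
    revealStep π i s g = s := if_neg hg

theorem giveAwayPhase_valid : (giveAwayPhase π (initState n m)).Valid :=
  (moves_giveAwayPhase π _).valid (initState_valid n m)

theorem startState_valid : (startState π i).Valid :=
  (moves_startState π i).valid (giveAwayPhase_valid π)

theorem revealStep_valid {s : AllocState n m} (hs : s.Valid) (g : Fin m) :
    (revealStep π i s g).Valid := by
  by_cases hg : g ∈ s.pool
  · exact (moves_revealStep hg).valid hs
  · rwa [revealStep_of_notMem hg]

theorem reveal_valid (t : ℕ) : (reveal π i t).Valid := by
  induction t with
  | zero => exact startState_valid π i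
  | succ t ih =>
    rw [reveal]
    split_ifs with h
    · exact revealStep_valid π i ih _
    · exact ih

theorem notMem_pool_revealStep (s : AllocState n m) (g : Fin m) :
    g ∉ (revealStep π i s g).pool := by
  by_cases hg : g ∈ s.pool
  · rw [revealStep, if_pos hg]
    intro h
    have := (moves_otherPicks π i _).pool_subset h
    simp [AllocState.assign] at this
  · rwa [revealStep_of_notMem hg]

theorem revealStep_pool_subset (s : AllocState n m) (g : Fin m) :
    (revealStep π i s g).pool ⊆ s.pool := by
  by_cases hg : g ∈ s.pool
  · exact (moves_revealStep hg).pool_subset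
  · rw [revealStep_of_notMem hg]

theorem reveal_pool_antitone : Antitone fun t => (reveal π i t).pool := by
  refine antitone_nat_of_succ_le fun t => ?_
  by_cases h : t < m
  · simp only [reveal_succ π i h]
    exact revealStep_pool_subset π i _ _
  · simp [reveal, h]

/-- An inspected item is out of the pool: it was taken before, or agent `i` picks it on inspection.
-/
theorem le_of_mem_pool_reveal {t : ℕ} {g : Fin m} (hg : g ∈ (reveal π i t).pool) :
    t ≤ ((π i).symm g : ℕ) := by
  induction t with
  | zero => exact Nat.zero_le _
  | succ t ih =>
    have h1 := ih (reveal_pool_antitone π i (Nat.le_succ t) hg)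
    rcases Nat.lt_or_ge t m with h | h
    · rcases Nat.lt_or_eq_of_le h1 with h2 | h2
      · exact h2
      · exfalso
        rw [reveal_succ π i h] at hg
        have h3 : g = π i ⟨t, h⟩ := by
          rw [← Equiv.symm_apply_eq]
          exact Fin.ext h2.symm
        rw [← h3] at hg
        exact notMem_pool_revealStep π i _ _ hg
    · have := ((π i).symm g).2
      omega

theorem reveal_bundle_subset (j : Fin n) {t t' : ℕ} (h : t ≤ t') :
    (reveal π i t).bundle j ⊆ (reveal π i t').bundle j := by
  induction t', h using Nat.le_induction with
  | base => exact subset_rfl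
  | succ t' _ ih =>
    refine ih.trans ?_
    rw [reveal]
    split_ifs with h
    · by_cases hg : π i ⟨t', h⟩ ∈ (reveal π i t').pool
      · exact (moves_revealStep hg).bundle_subset j
      · rw [revealStep_of_notMem hg]
    · exact subset_rfl

theorem mem_of_mem_reveal_bundle {j : Fin n} {t t' : ℕ} (h : t ≤ t') {g : Fin m}
    (hg : g ∈ (reveal π i t').bundle j) :
    g ∈ (reveal π i t).bundle j ∨ g ∈ (reveal π i t).pool := by
  induction t', h using Nat.le_induction with
  | base => exact Or.inl hg
  | succ t' ht ih =>
    rw [reveal] at hg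
    split_ifs at hg with h
    · by_cases hp : π i ⟨t', h⟩ ∈ (reveal π i t').pool
      · rcases (moves_revealStep hp).mem_of_mem_bundle hg with h1 | h1
        · exact ih h1
        · exact Or.inr (reveal_pool_antitone π i ht h1.1)
      · rw [revealStep_of_notMem hp] at hg
        exact ih hg
    · exact ih hg

/-- The items among the first `t` positions are settled once `t` items are inspected. -/
theorem reveal_bundle_filter (j : Fin n) {t t' : ℕ} (h : t ≤ t') :
    ((reveal π i t').bundle j).filter (fun g => ((π i).symm g : ℕ) < t)
      = ((reveal π i t).bundle j).filter (fun g => ((π i).symm g : ℕ) < t) := by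
  ext g
  simp only [Finset.mem_filter, and_congr_left_iff]
  intro hlt
  refine ⟨fun hg => ?_, fun hg => reveal_bundle_subset π i j h hg⟩
  refine (mem_of_mem_reveal_bundle π i h hg).resolve_right fun hp => ?_
  have := le_of_mem_pool_reveal π i hp
  omega

theorem reveal_pool_eq_empty : (reveal π i m).pool = ∅ := by
  rw [Finset.eq_empty_iff_forall_notMem]
  intro g hg
  have h1 := le_of_mem_pool_reveal π i hg
  have := ((π i).symm g).2
  omega

/-- Agent `i` takes only items that she has inspected, apart from those given to her. -/
theorem mem_startState_of_mem_reveal {t : ℕ} {g : Fin m} (hg : g ∈ (reveal π i t).bundle i)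
    (ht : t ≤ ((π i).symm g : ℕ)) : g ∈ (startState π i).bundle i := by
  induction t with
  | zero => exact hg
  | succ t ih =>
    have h : t < m := by have := ((π i).symm g).2; omega
    rw [reveal_succ π i h] at hg
    by_cases hp : π i ⟨t, h⟩ ∈ (reveal π i t).pool
    · rw [revealStep, if_pos hp,
        (moves_otherPicks π i _).bundle_eq_of_notMem (notMem_others i)] at hg
      simp only [AllocState.assign, Function.update_self, Finset.mem_insert] at hg
      rcases hg with rfl | hg
      · simp at ht
      · exact ih hg (by omega)
    · rw [revealStep_of_notMem hp] at hg
      exact ih hg (by omega)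

/-- All better items are already gone, so an available item in position `t` is her best available
one. -/
theorem revealStep_eq_pickStep {t : ℕ} (h : t < m) (hp : π i ⟨t, h⟩ ∈ (reveal π i t).pool) :
    revealStep π i (reveal π i t) (π i ⟨t, h⟩) = otherPicks π i (pickStep π (reveal π i t) i) := by
  rw [revealStep, if_pos hp, pickStep, dif_pos ⟨_, hp⟩]
  congr 2
  refine (bestItem_eq _ _ _ hp fun x hx => ?_).symm
  have := le_of_mem_pool_reveal π i hx
  rw [Equiv.symm_apply_apply, Fin.le_def]
  exact this

/-- Inspecting an unavailable item changes nothing; each other inspection is one round starting at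
agent `i`. -/
theorem exists_iterate_eq_reveal {t : ℕ} (ht : t ≤ m) :
    ∃ k ≤ t, reveal π i t = (fun s => otherPicks π i (pickStep π s i))^[k] (startState π i) := by
  induction t with
  | zero => exact ⟨0, le_rfl, rfl⟩
  | succ t ih =>
    obtain ⟨k, hk, he⟩ := ih (by omega)
    rw [reveal_succ π i ht]
    by_cases hp : π i ⟨t, ht⟩ ∈ (reveal π i t).pool
    · refine ⟨k + 1, by omega, ?_⟩
      rw [revealStep_eq_pickStep π i ht hp, Function.iterate_succ_apply', ← he]
    · exact ⟨k, by omega, by rw [revealStep_of_notMem hp, he]⟩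

theorem foldl_replicate_flatten {α β : Type*} (f : β → α → β) (l : List α) (k : ℕ) (b : β) :
    (List.replicate k l).flatten.foldl f b = (fun b => l.foldl f b)^[k] b := by
  induction k generalizing b with
  | zero => rfl
  | succ k ih =>
    rw [List.replicate_succ, List.flatten_cons, List.foldl_append, ih, Function.iterate_succ_apply]

theorem Moves.card_pool_lt {l : List (Fin n)} {s s' : AllocState n m} (h : Moves l s s')
    (hl : l ≠ []) (hs : s.pool.Nonempty) : s'.pool.card < s.pool.card := by
  cases h with
  | nil => exact absurd rfl hl
  | cons h hm =>
    rcases h with ⟨x, hx, rfl⟩ | ⟨he, rfl⟩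
    · refine lt_of_le_of_lt (Finset.card_le_card hm.pool_subset) ?_
      exact Finset.card_lt_card (Finset.erase_ssubset hx)
    · simp [he] at hs

/-- Up to the picks of the agents before `i`, rounds starting at the first agent and rounds starting
at `i` are conjugate, and void picks at the end do no harm. -/
theorem giveAwayRoundRobin_eq_reveal : giveAwayRoundRobin π = (reveal π i m).bundle := by
  set S := giveAwayPhase π (initState n m) with hS
  set R : AllocState n m → AllocState n m := fun s => (List.finRange n).foldl (pickStep π) s with hR
  set B : AllocState n m → AllocState n m := fun s => (agentsBefore i).foldl (pickStep π) s with hB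
  set Q : AllocState n m → AllocState n m := fun s => otherPicks π i (pickStep π s i) with hQ
  have hmR : ∀ s, Moves (List.finRange n) s (R s) := fun s => Moves.foldl (isMove_pickStep π) _ _
  have hne : List.finRange n ≠ [] := fun h => by
    have := List.mem_finRange i
    simp [h] at this
  -- Both sides process the agents before `i`, then `i`, then those after `i`, then those before `i`
  -- again.
  have hsemi : Function.Semiconj B R Q := by
    intro s
    simp only [hB, hR, hQ, otherPicks]
    rw [finRange_eq_append i]
    simp [List.foldl_append]
  have hcard : ∀ k, ((R^[k]) S).pool.card ≤ S.pool.card - k := by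
    intro k
    induction k with
    | zero => simp
    | succ k ih =>
      rw [Function.iterate_succ_apply']
      rcases ((R^[k]) S).pool.eq_empty_or_nonempty with he | hp
      · rw [(hmR _).eq_of_pool_empty he, he]; simp
      · have := (hmR _).card_pool_lt hne hp
        omega
  have hempty : ((R^[m]) S).pool = ∅ := by
    have h1 := hcard m
    have h2 : S.pool.card ≤ m := (Finset.card_le_univ _).trans (by simp)
    rw [← Finset.card_eq_zero]; omega
  have h1 : B ((R^[m]) S) = (R^[m]) S :=
    (Moves.foldl (isMove_pickStep π) (agentsBefore i) ((R^[m]) S)).eq_of_pool_empty hempty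
  have h2 : B ((R^[m]) S) = (Q^[m]) (startState π i) := (hsemi.iterate_right m) S
  obtain ⟨k, hk, he⟩ := exists_iterate_eq_reveal π i le_rfl
  have hfix : Q (reveal π i m) = reveal π i m := by
    have : Moves (i :: (agentsAfter i ++ agentsBefore i)) (reveal π i m) (Q (reveal π i m)) :=
      Moves.cons (isMove_pickStep π _ i) (moves_otherPicks π i _)
    exact this.eq_of_pool_empty (reveal_pool_eq_empty π i)
  -- The inspections use only `k ≤ m` rounds; the other `m - k` act on an empty pool.
  have h3 : (Q^[m]) (startState π i) = reveal π i m := by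
    have h : (Q^[(m - k) + k]) (startState π i) = reveal π i m := by
      rw [Function.iterate_add_apply, ← he]
      exact Function.iterate_fixed hfix _
    rwa [Nat.sub_add_cancel hk] at h
  have h4 : roundRobinPhase π S = (R^[m]) S := foldl_replicate_flatten _ _ _ _
  rw [← h3, ← h2, h1, ← h4]
  rfl

theorem isAllocation_giveAwayRoundRobin (i : Fin n) : IsAllocation (giveAwayRoundRobin π) := by
  rw [giveAwayRoundRobin_eq_reveal π i]
  have hv := reveal_valid π i m
  refine ⟨hv.disjoint, fun g => (hv.cover g).resolve_left ?_⟩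
  simp [reveal_pool_eq_empty]

theorem AllocState.Valid.card_add_sum {s : AllocState n m} (hs : s.Valid) :
    s.pool.card + ∑ j, (s.bundle j).card = m := by
  classical
  have h1 : (Finset.univ.biUnion s.bundle).card = ∑ j, (s.bundle j).card :=
    Finset.card_biUnion fun a _ b _ hab => hs.disjoint a b hab
  rw [← h1, ← Finset.card_union_of_disjoint]
  · have : s.pool ∪ Finset.univ.biUnion s.bundle = Finset.univ := by
      ext g; simpa using hs.cover g
    rw [this, Finset.card_univ, Fintype.card_fin]
  · rw [Finset.disjoint_biUnion_right]
    exact fun a _ => hs.disjoint_pool a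

end

/-! ### Bundle sizes -/

section

variable {n m : ℕ} (π : Fin n → PrefOrder m) (i : Fin n)

/-- Phase 1 hands out `n * (n - 1) < n * n ≤ m` items, so no gift is void and everyone receives one
from each other agent. -/
theorem card_giveAwayPhase_bundle (hm : n * n ≤ m) (j : Fin n) :
    ((giveAwayPhase π (initState n m)).bundle j).card = n - 1 := by
  have hM := moves_giveAwayPhase π (initState n m)
  have hn : 0 < n := Fin.pos j
  have h1 := hM.card_pool_le
  rw [length_flatMap_recipients, List.length_finRange] at h1
  have h2 : (initState n m).pool.card = m := by simp [initState]
  have h3 : n * (n - 1) < n * n := Nat.mul_lt_mul_of_pos_left (by omega) hn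
  have hp : (giveAwayPhase π (initState n m)).pool.Nonempty := by
    rw [← Finset.card_pos]; omega
  have h4 := hM.card_bundle_eq (initState_valid n m) hp j
  have h5 := count_flatMap_recipients (List.finRange n) j
  rw [List.count_eq_one_of_mem (List.nodup_finRange n) (List.mem_finRange j),
    List.length_finRange] at h5
  rw [h4]
  simp only [initState, Finset.card_empty]
  omega

theorem card_startState_bundle_self (hm : n * n ≤ m) :
    ((startState π i).bundle i).card = n - 1 := by
  rw [(moves_startState π i).bundle_eq_of_notMem (notMem_agentsBefore i),
    card_giveAwayPhase_bundle π hm]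

theorem le_card_startState_bundle (hm : n * n ≤ m) (j : Fin n) :
    n - 1 ≤ ((startState π i).bundle j).card := by
  rw [← card_giveAwayPhase_bundle π hm j]
  exact Finset.card_le_card ((moves_startState π i).bundle_subset j)

theorem card_startState_bundle_le (hm : n * n ≤ m) (j : Fin n) :
    ((startState π i).bundle j).card ≤ n := by
  have h1 := (moves_startState π i).card_bundle_le (giveAwayPhase_valid π) j
  rw [card_giveAwayPhase_bundle π hm j] at h1
  have h2 : (agentsBefore i).count j ≤ 1 := by
    have h3 := count_agents i j
    rw [List.count_cons, List.count_append] at h3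
    omega
  have := Fin.pos j
  omega

theorem le_card_startState_pool : m ≤ (startState π i).pool.card + n * n := by
  have h1 := (moves_giveAwayPhase π (initState n m)).card_pool_le
  have h2 := (moves_startState π i).card_pool_le
  rw [length_flatMap_recipients, List.length_finRange] at h1
  rw [length_agentsBefore] at h2
  have h3 : (initState n m).pool.card = m := by simp [initState]
  have h4 : n * (n - 1) + n = n * n := by
    have := Fin.pos i
    obtain ⟨k, rfl⟩ : ∃ k, n = k + 1 := ⟨n - 1, by omega⟩
    rw [Nat.add_sub_cancel]; ring
  have := i.2
  omega

theorem le_card_reveal_pool (t : ℕ) : m ≤ (reveal π i t).pool.card + n * n + n * t := by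
  induction t with
  | zero => exact le_card_startState_pool π i
  | succ t ih =>
    rw [reveal]
    split_ifs with h
    · by_cases hp : π i ⟨t, h⟩ ∈ (reveal π i t).pool
      · have h1 := (moves_revealStep (π := π) (i := i) hp).card_pool_le
        rw [length_agents] at h1
        rw [Nat.mul_succ]; omega
      · rw [revealStep_of_notMem hp, Nat.mul_succ]; omega
    · rw [Nat.mul_succ]; omega

theorem card_revealStep_bundle_self {s : AllocState n m} (hs : s.Valid) {g : Fin m} (hg : g ∈ s.pool) :
    ((revealStep π i s g).bundle i).card = (s.bundle i).card + 1 := by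
  rw [revealStep, if_pos hg, (moves_otherPicks π i _).bundle_eq_of_notMem (notMem_others i),
    assign_bundle_card hs i i hg, if_pos rfl]

/-- The lead of one comes from agents who pick before `i` in a round; afterwards each productive
inspection gives `i` one item and `j` at most one. -/
theorem card_reveal_bundle_le_succ (hm : n * n ≤ m) (j : Fin n) (t : ℕ) :
    ((reveal π i t).bundle j).card ≤ ((reveal π i t).bundle i).card + 1 := by
  induction t with
  | zero =>
    have h1 := card_startState_bundle_le π i hm j
    have h2 := card_startState_bundle_self π i hm
    change ((startState π i).bundle j).card ≤ ((startState π i).bundle i).card + 1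
    omega
  | succ t ih =>
    rw [reveal]
    split_ifs with h
    · by_cases hp : π i ⟨t, h⟩ ∈ (reveal π i t).pool
      · have h1 := (moves_revealStep (π := π) (i := i) hp).card_bundle_le (reveal_valid π i t) j
        rw [count_agents] at h1
        rw [card_revealStep_bundle_self π i (reveal_valid π i t) hp]
        omega
      · rwa [revealStep_of_notMem hp]
    · exact ih

/-- Agent `i` can get ahead of `j` only in a final round that is cut short. The second clause is
what carries the induction. -/
theorem card_reveal_self_le (hm : n * n ≤ m) (j : Fin n) (t : ℕ) :
    ((reveal π i t).bundle i).card ≤ ((reveal π i t).bundle j).card + 1 ∧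
      ((reveal π i t).pool.Nonempty →
        ((reveal π i t).bundle i).card ≤ ((reveal π i t).bundle j).card) := by
  induction t with
  | zero =>
    have h1 := le_card_startState_bundle π i hm j
    have h2 := card_startState_bundle_self π i hm
    change ((startState π i).bundle i).card ≤ ((startState π i).bundle j).card + 1 ∧ (_ →
      ((startState π i).bundle i).card ≤ ((startState π i).bundle j).card)
    omega
  | succ t ih =>
    rw [reveal]
    split_ifs with h
    · by_cases hp : π i ⟨t, h⟩ ∈ (reveal π i t).pool
      · have h1 := ih.2 ⟨_, hp⟩
        have h2 := Finset.card_le_card ((moves_revealStep (π := π) (i := i) hp).bundle_subset j)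
        rw [card_revealStep_bundle_self π i (reveal_valid π i t) hp]
        refine ⟨by omega, fun hne => ?_⟩
        have h3 := (moves_revealStep (π := π) (i := i) hp).card_bundle_eq (reveal_valid π i t) hne j
        rw [count_agents] at h3
        omega
      · rwa [revealStep_of_notMem hp]
    · exact ih

/-- The first `t` items are all allocated, and no bundle exceeds that of `j` by more than two: one
from `j` to `i` and one from `i` to any other agent. -/
theorem le_mul_card_reveal_bundle (hm : n * n ≤ m) (j : Fin n) {t : ℕ} (ht : t ≤ m) :
    t ≤ n * (((reveal π i t).bundle j).card + 2) := by
  have h1 := (reveal_valid π i t).card_add_sum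
  have h2 : (reveal π i t).pool.card ≤ m - t := by
    rw [← card_itemsIn (π i) (t := t) (le_refl m)]
    refine Finset.card_le_card fun g hg => ?_
    rw [mem_itemsIn]
    exact ⟨le_of_mem_pool_reveal π i hg, Fin.is_lt _⟩
  have h3 : ∑ k, ((reveal π i t).bundle k).card ≤ n * (((reveal π i t).bundle j).card + 2) := by
    calc ∑ k, ((reveal π i t).bundle k).card
        ≤ ∑ _k : Fin n, (((reveal π i t).bundle j).card + 2) := by
          refine Finset.sum_le_sum fun k _ => ?_
          have h4 := card_reveal_bundle_le_succ π i hm k t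
          have h5 := (card_reveal_self_le π i hm j t).1
          omega
      _ = _ := by simp
  omega

/-- Final sizes differ pairwise by at most one and add up to a multiple of `n`, so they are equal.
-/
theorem card_giveAwayRoundRobin (hm : n * n ≤ m) {q : ℕ} (hq : m = q * n) (j k : Fin n) :
    (giveAwayRoundRobin π j).card ≤ (giveAwayRoundRobin π k).card := by
  have hle : ∀ a b, (giveAwayRoundRobin π a).card ≤ (giveAwayRoundRobin π b).card + 1 := by
    intro a b
    rw [giveAwayRoundRobin_eq_reveal π b]
    exact card_reveal_bundle_le_succ π b hm a m
  have hsum : ∑ a, (giveAwayRoundRobin π a).card = m := by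
    have h := (reveal_valid π j m).card_add_sum
    rw [reveal_pool_eq_empty, Finset.card_empty, zero_add] at h
    rwa [giveAwayRoundRobin_eq_reveal π j]
  by_contra hlt
  set v := (giveAwayRoundRobin π k).card with hv
  have h1 : n * v < m := by
    rw [← hsum]
    calc n * v = ∑ _a : Fin n, v := by simp
      _ < ∑ a, (giveAwayRoundRobin π a).card := by
        refine Finset.sum_lt_sum (fun a _ => ?_) ⟨j, Finset.mem_univ _, by omega⟩
        have := hle j a
        omega
  have h2 : m < n * (v + 1) := by
    rw [← hsum]
    calc ∑ a, (giveAwayRoundRobin π a).card < ∑ _a : Fin n, (v + 1) := by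
          refine Finset.sum_lt_sum (fun a _ => hle a k) ⟨k, Finset.mem_univ _, by omega⟩
      _ = n * (v + 1) := by simp
  rw [hq, Nat.mul_comm q n] at h1 h2
  have h3 := lt_of_mul_lt_mul_left h1 (Nat.zero_le _)
  have h4 := lt_of_mul_lt_mul_left h2 (Nat.zero_le _)
  omega

/-! ### The giving turn on the good event, and what is independent of the first positions -/

/-- The state in which agent `i` starts to give away items. -/
def stateBeforeGiving : AllocState n m :=
  (agentsBefore i).foldl (giveTurn π) (initState n m)

/-- The last `n - 1` items of agent `i` are available when she starts to give away items. -/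
def LastItemsAvailable : Prop :=
  ∀ k : Fin m, m + 1 - n ≤ (k : ℕ) → π i k ∈ (stateBeforeGiving π i).pool

theorem moves_stateBeforeGiving :
    Moves ((agentsBefore i).flatMap recipients) (initState n m) (stateBeforeGiving π i) :=
  moves_giveTurns π _ _

theorem giveAwayPhase_eq_foldl : giveAwayPhase π (initState n m)
    = (agentsAfter i).foldl (giveTurn π) (giveTurn π (stateBeforeGiving π i) i) := by
  rw [giveAwayPhase_eq, finRange_eq_append i, List.foldl_append, List.foldl_cons]
  rfl

theorem moves_after_giving : Moves ((agentsAfter i).flatMap recipients)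
    (giveTurn π (stateBeforeGiving π i) i) (giveAwayPhase π (initState n m)) := by
  rw [giveAwayPhase_eq_foldl π i]
  exact moves_giveTurns π _ _

variable {π i}

theorem giveTurn_spec (h : LastItemsAvailable π i) (hm : n ≤ m) :
    (∀ g ∈ (giveTurn π (stateBeforeGiving π i) i).pool, ((π i).symm g : ℕ) < m + 1 - n) ∧
    (∀ j, j ≠ i → ∃ g ∈ (giveTurn π (stateBeforeGiving π i) i).bundle j,
      m + 1 - n ≤ ((π i).symm g : ℕ)) ∧
    (∀ π' : Fin n → PrefOrder m, (∀ k : Fin m, m + 1 - n ≤ (k : ℕ) → π' i k = π i k) →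
      giveTurn π' (stateBeforeGiving π i) i = giveTurn π (stateBeforeGiving π i) i) := by
  have hn := Fin.pos i
  have hM : m - (recipients i).length = m + 1 - n := by rw [length_recipients]; omega
  have := foldl_giveStep_spec π i (recipients i) (stateBeforeGiving π i) m
    (by rw [length_recipients]; omega) le_rfl (fun g _ => Fin.is_lt _)
    (fun k hk _ => h k (hM ▸ hk))
  rw [hM] at this
  exact ⟨this.1, fun j hj => this.2.1 j (mem_recipients.2 hj), this.2.2⟩

theorem lt_of_mem_startState_pool (h : LastItemsAvailable π i) (hm : n ≤ m) {g : Fin m}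
    (hg : g ∈ (startState π i).pool) : ((π i).symm g : ℕ) < m + 1 - n :=
  (giveTurn_spec h hm).1 g
    ((moves_after_giving π i).pool_subset ((moves_startState π i).pool_subset hg))

theorem exists_last_item (h : LastItemsAvailable π i) (hm : n ≤ m) {j : Fin n} (hj : j ≠ i) :
    ∃ g ∈ (startState π i).bundle j, m + 1 - n ≤ ((π i).symm g : ℕ) := by
  obtain ⟨g, hg, hge⟩ := (giveTurn_spec h hm).2.1 j hj
  exact ⟨g, (moves_startState π i).bundle_subset j ((moves_after_giving π i).bundle_subset j hg),
    hge⟩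

/-- Gifts made before her turn avoid her last `n - 1` items, which are still available then; gifts
made later come from a pool that no longer contains them. -/
theorem lt_of_mem_startState_bundle (h : LastItemsAvailable π i) (hm : n ≤ m) {g : Fin m}
    (hg : g ∈ (startState π i).bundle i) : ((π i).symm g : ℕ) < m + 1 - n := by
  rw [(moves_startState π i).bundle_eq_of_notMem (notMem_agentsBefore i)] at hg
  rcases (moves_after_giving π i).mem_of_mem_bundle hg with h1 | h1
  · rw [(moves_giveTurn π _ i).bundle_eq_of_notMem (fun h => mem_recipients.1 h rfl)] at h1
    by_contra hlt
    have h2 := h ((π i).symm g) (not_lt.1 hlt)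
    rw [Equiv.apply_symm_apply] at h2
    have hv := (moves_stateBeforeGiving π i).valid (initState_valid n m)
    exact Finset.disjoint_left.1 (hv.disjoint_pool i) h2 h1
  · exact (giveTurn_spec h hm).1 g h1.1

theorem swapAt_apply_of_le {u v : Fin m} {M : ℕ} (hu : (u : ℕ) < M) (hv : (v : ℕ) < M) (k : Fin m)
    (hk : M ≤ (k : ℕ)) : swapAt i u v π i k = π i k :=
  swapAt_apply_of_ne i u v k π (by rintro rfl; omega) (by rintro rfl; omega)

variable (π i) in
theorem stateBeforeGiving_swapAt (u v : Fin m) :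
    stateBeforeGiving (swapAt i u v π) i = stateBeforeGiving π i :=
  foldl_giveTurn_congr (fun j hj => swapAt_of_ne (by rintro rfl; exact notMem_agentsBefore _ hj) _ _ _) _

theorem LastItemsAvailable.of_swapAt (h : LastItemsAvailable π i) {u v : Fin m}
    (hu : (u : ℕ) < m + 1 - n) (hv : (v : ℕ) < m + 1 - n) :
    LastItemsAvailable (swapAt i u v π) i := by
  intro k hk
  rw [swapAt_apply_of_le hu hv k hk, stateBeforeGiving_swapAt]
  exact h k hk

/-- Up to her first pick, the order of agent `i` is consulted only in her giving turn, which depends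
only on her last `n - 1` positions. -/
theorem startState_swapAt (h : LastItemsAvailable π i) (hm : n ≤ m) {u v : Fin m}
    (hu : (u : ℕ) < m + 1 - n) (hv : (v : ℕ) < m + 1 - n) :
    startState (swapAt i u v π) i = startState π i := by
  have h1 : ∀ j, j ≠ i → swapAt i u v π j = π j := fun j hj => swapAt_of_ne hj _ _ _
  unfold startState
  rw [foldl_pickStep_congr (fun j hj => h1 j (by rintro rfl; exact notMem_agentsBefore _ hj)),
    giveAwayPhase_eq_foldl _ i, giveAwayPhase_eq_foldl _ i, stateBeforeGiving_swapAt,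
    foldl_giveTurn_congr (fun j hj => h1 j (by rintro rfl; exact notMem_agentsAfter _ hj)),
    (giveTurn_spec h hm).2.2 _ (swapAt_apply_of_le hu hv)]

theorem revealStep_swapAt (u v : Fin m) (s : AllocState n m) (g : Fin m) :
    revealStep (swapAt i u v π) i s g = revealStep π i s g := by
  unfold revealStep otherPicks
  rw [foldl_pickStep_congr (fun j hj => swapAt_of_ne (ne_of_mem_others hj) _ _ _)]

/-- The first `t` inspections do not depend on the arrangement of the later positions. -/
theorem reveal_swapAt (h : LastItemsAvailable π i) (hm : n ≤ m) {u v : Fin m}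
    (hu : (u : ℕ) < m + 1 - n) (hv : (v : ℕ) < m + 1 - n) {t : ℕ} (htu : t ≤ u) (htv : t ≤ v) :
    reveal (swapAt i u v π) i t = reveal π i t := by
  induction t with
  | zero => exact startState_swapAt h hm hu hv
  | succ t ih =>
    have ht : t < m := by have := u.2; omega
    rw [reveal_succ _ _ ht, reveal_succ _ _ ht, ih (by omega) (by omega), revealStep_swapAt,
      swapAt_apply_of_ne i u v ⟨t, ht⟩ π (by intro e; have := congrArg Fin.val e; simp at this; omega)
        (by intro e; have := congrArg Fin.val e; simp at this; omega)]

theorem itemsIn_swapAt {u v : Fin m} {t M : ℕ} (hu : (u : ℕ) < M) (hv : (v : ℕ) < M) (htu : t ≤ u)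
    (htv : t ≤ v) : itemsIn (swapAt i u v π i) t M = itemsIn (π i) t M := by
  ext g
  rw [mem_itemsIn, mem_itemsIn, swapAt_symm_apply]
  rcases eq_or_ne ((π i).symm g) u with h | h
  · rw [h, Equiv.swap_apply_left]; omega
  · rcases eq_or_ne ((π i).symm g) v with h' | h'
    · rw [h', Equiv.swap_apply_right]; omega
    · rw [Equiv.swap_apply_of_ne_of_ne h h']

/-! ### Envy and uninspected items -/

/-- The number of items of agent `j` that agent `i` has not inspected, her last `n - 1` items
aside. -/
def uninspected (π : Fin n → PrefOrder m) (i j : Fin n) (t : ℕ) : ℕ :=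
  ((reveal π i t).bundle j ∩ itemsIn (π i) t (m + 1 - n)).card

/-- The number of items of `A` among the first `t` positions. -/
def countBelow (σ : PrefOrder m) (t : ℕ) (A : Finset (Fin m)) : ℕ :=
  (A.filter fun g => (σ.symm g : ℕ) < t).card

theorem lt_of_mem_reveal_self (h : LastItemsAvailable π i) (hm : n ≤ m) {t : ℕ} {g : Fin m}
    (hg : g ∈ (reveal π i t).bundle i) : ((π i).symm g : ℕ) < m + 1 - n := by
  rcases mem_of_mem_reveal_bundle π i (Nat.zero_le t) hg with h1 | h1
  · exact lt_of_mem_startState_bundle h hm h1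
  · exact lt_of_mem_startState_pool h hm h1

/-- Envy at some threshold requires that agent `i` holds more uninspected items than agent `j`. -/
theorem uninspected_lt_of_envy (h : LastItemsAvailable π i) (hm : n * n ≤ m) {j : Fin n}
    (hj : j ≠ i) {t : ℕ} (ht : t ≤ m + 1 - n)
    (henvy : countBelow (π i) t (giveAwayRoundRobin π i)
      < countBelow (π i) t (giveAwayRoundRobin π j)) :
    uninspected π i j t < uninspected π i i t := by
  have hn := Fin.pos i
  have hnm : n ≤ m := (Nat.le_mul_of_pos_left n hn).trans hm
  have htm : t ≤ m := by omega
  rw [giveAwayRoundRobin_eq_reveal π i] at henvy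
  unfold countBelow at henvy
  rw [reveal_bundle_filter π i i htm, reveal_bundle_filter π i j htm] at henvy
  have hsize := card_reveal_bundle_le_succ π i hm j t
  have hi : ((reveal π i t).bundle i).card
      ≤ (((reveal π i t).bundle i).filter (fun g => ((π i).symm g : ℕ) < t)).card
        + uninspected π i i t := by
    unfold uninspected
    refine (Finset.card_le_card fun g hg => ?_).trans (Finset.card_union_le _ _)
    rw [Finset.mem_union, Finset.mem_filter, Finset.mem_inter, mem_itemsIn]
    have := lt_of_mem_reveal_self h hnm hg
    by_cases hlt : ((π i).symm g : ℕ) < t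
    · exact Or.inl ⟨hg, hlt⟩
    · exact Or.inr ⟨hg, by omega, this⟩
  -- The extra `1` is an item that `i` gave to `j` out of her last `n - 1`; neither summand counts
  -- it, and it cancels the lead of one in `hsize`. This is the purpose of Phase 1.
  have hjc : (((reveal π i t).bundle j).filter (fun g => ((π i).symm g : ℕ) < t)).card
        + uninspected π i j t + 1 ≤ ((reveal π i t).bundle j).card := by
    obtain ⟨x, hx, hxp⟩ := exists_last_item h hnm hj
    have hx' : x ∈ (reveal π i t).bundle j := reveal_bundle_subset π i j (Nat.zero_le t) hx
    unfold uninspected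
    rw [← Finset.card_union_of_disjoint, ← Finset.card_insert_of_notMem (a := x)]
    · refine Finset.card_le_card fun g hg => ?_
      rw [Finset.mem_insert, Finset.mem_union, Finset.mem_filter, Finset.mem_inter] at hg
      rcases hg with rfl | hg | hg
      · exact hx'
      · exact hg.1
      · exact hg.1
    · rw [Finset.mem_union, Finset.mem_filter, Finset.mem_inter, mem_itemsIn]
      omega
    · rw [Finset.disjoint_left]
      intro g hg hg'
      rw [Finset.mem_filter] at hg
      rw [Finset.mem_inter, mem_itemsIn] at hg'
      omega
  omega

/-- Her picks are inspected items, so only the `n - 1` gifts of Phase 1 can be uninspected. -/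
theorem uninspected_self_le (hm : n * n ≤ m) (t : ℕ) : uninspected π i i t ≤ n - 1 := by
  rw [← card_startState_bundle_self π i hm]
  refine Finset.card_le_card fun g hg => ?_
  rw [Finset.mem_inter, mem_itemsIn] at hg
  exact mem_startState_of_mem_reveal π i hg.1 hg.2.1

/-- All her items lie in the first `m + 1 - n` positions, so her count is her bundle size, which
equals that of `j`. -/
theorem no_envy_of_lt (h : LastItemsAvailable π i) (hm : n * n ≤ m) {q : ℕ} (hq : m = q * n)
    (j : Fin n) {t : ℕ} (ht : m + 1 - n ≤ t) :
    countBelow (π i) t (giveAwayRoundRobin π j) ≤ countBelow (π i) t (giveAwayRoundRobin π i) := by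
  have hn := Fin.pos i
  have hnm : n ≤ m := (Nat.le_mul_of_pos_left n hn).trans hm
  have h1 : countBelow (π i) t (giveAwayRoundRobin π i) = (giveAwayRoundRobin π i).card := by
    unfold countBelow
    rw [Finset.filter_true_of_mem]
    intro g hg
    rw [giveAwayRoundRobin_eq_reveal π i] at hg
    exact lt_of_lt_of_le (lt_of_mem_reveal_self h hnm hg) ht
  rw [h1]
  exact (Finset.card_filter_le _ _).trans (card_giveAwayRoundRobin π hm hq j i)

end

/-! ### One inspection with a random next item; missed items -/

section

variable {n m : ℕ} {π : Fin n → PrefOrder m} {i : Fin n}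

theorem symm_swapAt_of_lt {p u : Fin m} {g : Fin m} (hpu : (p : ℕ) ≤ u)
    (hg : ((swapAt i p u π i).symm g : ℕ) < p) :
    (swapAt i p u π i).symm g = (π i).symm g := by
  rw [swapAt_symm_apply] at hg ⊢
  rcases eq_or_ne ((π i).symm g) p with h | h
  · rw [h, Equiv.swap_apply_left] at hg; omega
  · rcases eq_or_ne ((π i).symm g) u with h' | h'
    · rw [h', Equiv.swap_apply_right] at hg; omega
    · rw [Equiv.swap_apply_of_ne_of_ne h h']

/-- Exchanging `p` with `u` keeps the history up to `p` and makes `π i u` the next inspected item;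
averaging over `u` therefore makes one random step. -/
theorem reveal_succ_swapAt (h : LastItemsAvailable π i) (hm : n ≤ m) {p u : Fin m}
    (hpu : (p : ℕ) ≤ u) (hu : (u : ℕ) < m + 1 - n) :
    reveal (swapAt i p u π) i (p + 1) = revealStep π i (reveal π i p) (π i u) := by
  rw [reveal_succ _ _ p.2, reveal_swapAt h hm (lt_of_le_of_lt hpu hu) hu le_rfl hpu,
    revealStep_swapAt]
  congr 1
  exact swapAt_apply_left i p u π

theorem itemsIn_succ_swapAt {p u : Fin m} {M : ℕ} (hpu : (p : ℕ) ≤ u) (hu : (u : ℕ) < M) :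
    itemsIn (swapAt i p u π i) (p + 1) M = (itemsIn (π i) p M).erase (π i u) := by
  rw [← itemsIn_swapAt (lt_of_le_of_lt hpu hu) hu le_rfl hpu]
  ext g
  rw [Finset.mem_erase, mem_itemsIn, mem_itemsIn, ← swapAt_apply_left i p u π]
  have : g ≠ swapAt i p u π i p ↔ ((swapAt i p u π i).symm g : ℕ) ≠ p := by
    rw [not_iff_not, ← Equiv.symm_apply_eq, Fin.ext_iff]
  rw [this]
  omega

/-- The number of items among the first `t` positions of agent `i` that she does not get. -/
def missed (π : Fin n → PrefOrder m) (i : Fin n) (t : ℕ) : ℕ :=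
  countBelow (π i) t ((reveal π i t).bundle i)ᶜ

theorem countBelow_add_compl (σ : PrefOrder m) {t : ℕ} (ht : t ≤ m) (A : Finset (Fin m)) :
    countBelow σ t A + countBelow σ t Aᶜ = t := by
  have h1 := card_itemsIn σ (t := 0) ht
  rw [Nat.sub_zero] at h1
  unfold countBelow
  rw [← Finset.card_union_of_disjoint, ← Finset.filter_union, Finset.union_compl]
  · conv_rhs => rw [← h1]
    congr 1
    ext g; simp [mem_itemsIn]
  · exact Finset.disjoint_filter_filter disjoint_compl_right

theorem countBelow_reveal (j : Fin n) {t t' : ℕ} (h : t ≤ t') :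
    countBelow (π i) t ((reveal π i t').bundle j) = countBelow (π i) t ((reveal π i t).bundle j) := by
  unfold countBelow
  rw [reveal_bundle_filter π i j h]

theorem missed_mono {t t' : ℕ} (h : t ≤ t') (ht' : t' ≤ m) : missed π i t ≤ missed π i t' := by
  have h1 := countBelow_add_compl (π i) (h.trans ht') ((reveal π i t).bundle i)
  have h2 := countBelow_add_compl (π i) (h.trans ht') ((reveal π i t').bundle i)
  rw [countBelow_reveal i h] at h2
  have h3 : countBelow (π i) t ((reveal π i t').bundle i)ᶜ
      ≤ countBelow (π i) t' ((reveal π i t').bundle i)ᶜ :=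
    Finset.card_le_card (Finset.monotone_filter_right _ fun g _ hg => lt_of_lt_of_le hg h)
  unfold missed
  omega

/-- All items of `j` in the prefix are missed by `i`, who holds the remaining `t - missed π i t`. -/
theorem lt_two_mul_missed_of_envy {j : Fin n} (hj : j ≠ i) {t : ℕ} (ht : t ≤ m)
    (henvy : countBelow (π i) t (giveAwayRoundRobin π i)
      < countBelow (π i) t (giveAwayRoundRobin π j)) : t < 2 * missed π i t := by
  rw [giveAwayRoundRobin_eq_reveal π i, countBelow_reveal i ht, countBelow_reveal j ht] at henvy
  have h1 := countBelow_add_compl (π i) ht ((reveal π i t).bundle i)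
  have h2 : countBelow (π i) t ((reveal π i t).bundle j)
      ≤ countBelow (π i) t ((reveal π i t).bundle i)ᶜ := by
    refine Finset.card_le_card (Finset.filter_subset_filter _ fun g hg => ?_)
    rw [Finset.mem_compl]
    exact fun h => Finset.disjoint_left.1 ((reveal_valid π i t).disjoint j i hj) hg h
  unfold missed
  omega

/-- An available item is picked, so only an item outside the pool can be missed. Such an item may
also be a gift to `i`, hence only an inequality. -/
theorem missed_succ_le (h : LastItemsAvailable π i) (hm : n ≤ m) {p u : Fin m}
    (hpu : (p : ℕ) ≤ u) (hu : (u : ℕ) < m + 1 - n) :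
    missed (swapAt i p u π) i (p + 1)
      ≤ missed π i p + if π i u ∈ (reveal π i p).pool then 0 else 1 := by
  unfold missed countBelow
  rw [reveal_succ_swapAt h hm hpu hu]
  have hsub : ∀ g ∈ ((revealStep π i (reveal π i p) (π i u)).bundle i)ᶜ.filter
      (fun g => ((swapAt i p u π i).symm g : ℕ) < p + 1),
      g ∈ ((reveal π i p).bundle i)ᶜ.filter (fun g => ((π i).symm g : ℕ) < p) ∨
        (g = π i u ∧ π i u ∉ (reveal π i p).pool) := by
    intro g hg
    rw [Finset.mem_filter, Finset.mem_compl] at hg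
    rcases Nat.lt_or_ge ((swapAt i p u π i).symm g : ℕ) p with hlt | hge
    · left
      rw [symm_swapAt_of_lt hpu hlt] at hlt
      rw [Finset.mem_filter, Finset.mem_compl]
      refine ⟨fun hgi => hg.1 ?_, hlt⟩
      by_cases hp : π i u ∈ (reveal π i p).pool
      · exact (moves_revealStep hp).bundle_subset i hgi
      · rwa [revealStep_of_notMem hp]
    · right
      have h1 : (swapAt i p u π i).symm g = p := Fin.ext (by omega)
      rw [Equiv.symm_apply_eq, swapAt_apply_left] at h1
      refine ⟨h1, fun hp => hg.1 ?_⟩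
      rw [h1, revealStep, if_pos hp]
      refine (moves_otherPicks π i _).bundle_subset i ?_
      simp [AllocState.assign]
  split_ifs with hp
  · refine Finset.card_le_card fun g hg => (hsub g hg).resolve_right fun h => h.2 hp
  · refine (Finset.card_le_card (t := insert (π i u) _) fun g hg => ?_).trans
      (Finset.card_insert_le _ _)
    rw [Finset.mem_insert]
    rcases hsub g hg with h | h
    · exact Or.inr h
    · exact Or.inl h.1

theorem card_window_filter (σ : PrefOrder m) (t M : ℕ) (S : Finset (Fin m)) :
    ((window m t M).filter fun u => σ u ∈ S).card = (S ∩ itemsIn σ t M).card := by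
  rw [← Finset.card_map σ.toEmbedding]
  congr 1
  ext g
  simp only [Finset.mem_map, Finset.mem_filter, mem_window, Finset.mem_inter, mem_itemsIn,
    Equiv.coe_toEmbedding]
  constructor
  · rintro ⟨k, ⟨h1, h2⟩, rfl⟩; simpa [h2] using h1
  · rintro ⟨h1, h2⟩; exact ⟨σ.symm g, ⟨h2, by simpa using h1⟩, by simp⟩

theorem card_window_filter_not (σ : PrefOrder m) {t M : ℕ} (hM : M ≤ m) {S : Finset (Fin m)}
    (hS : S ⊆ itemsIn σ t M) :
    ((window m t M).filter fun u => σ u ∉ S).card + S.card = M - t := by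
  have h1 := Finset.card_filter_add_card_filter_not (s := window m t M) (fun u => σ u ∈ S)
  rw [card_window_filter, Finset.inter_eq_left.2 hS, card_window hM] at h1
  omega

theorem reveal_pool_subset_itemsIn (h : LastItemsAvailable π i) (hm : n ≤ m) (t : ℕ) :
    (reveal π i t).pool ⊆ itemsIn (π i) t (m + 1 - n) := by
  intro g hg
  rw [mem_itemsIn]
  exact ⟨le_of_mem_pool_reveal π i hg,
    lt_of_mem_startState_pool h hm (reveal_pool_antitone π i (Nat.zero_le t) hg)⟩

/-! ### Exponential moments of the number of missed items -/

open Classical in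
/-- The profiles in which agent `i` gives away exactly her last `n - 1` items. -/
noncomputable def goodProfiles (n m : ℕ) (i : Fin n) : Finset (Fin n → PrefOrder m) :=
  Finset.univ.filter fun π => LastItemsAvailable π i

theorem mem_goodProfiles : π ∈ goodProfiles n m i ↔ LastItemsAvailable π i := by
  simp [goodProfiles]

theorem swapClosed_goodProfiles : SwapClosed i (m + 1 - n) (goodProfiles n m i) := by
  intro π hπ u v hu hv
  rw [mem_goodProfiles] at hπ ⊢
  exact hπ.of_swapAt hu hv

/-- At each step up to `T` the next item is unavailable with conditional probability at most `ε`, so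
the moment grows by a factor of at most `1 + (θ - 1) * ε`. -/
theorem sum_pow_missed_le (hm : n ≤ m) {θ ε : ℝ} (hθ : 1 ≤ θ) (hε : 0 ≤ ε) {T : ℕ}
    (hT : T ≤ m + 1 - n)
    (hεT : (n * n + n * T : ℝ) ≤ ε * ((m + 1 - n : ℕ) - T)) {t : ℕ} (ht : t ≤ T) :
    ∑ π ∈ goodProfiles n m i, θ ^ missed π i t
      ≤ (1 + (θ - 1) * ε) ^ t * (goodProfiles n m i).card := by
  have hn := Fin.pos i
  induction t with
  | zero =>
    have : ∀ π ∈ goodProfiles n m i, θ ^ missed π i 0 = 1 := by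
      intro π _
      simp [missed, countBelow]
    rw [Finset.sum_congr rfl this]
    simp
  | succ t ih =>
    have htM : t < m + 1 - n := by omega
    have hcast : (((m + 1 - n) - t : ℕ) : ℝ) = ((m + 1 - n : ℕ) : ℝ) - t := by
      rw [Nat.cast_sub htM.le]
    have key := sum_le_of_swap_average (i := i) (M := m + 1 - n) (by omega)
      swapClosed_goodProfiles ⟨t, by omega⟩ htM (fun π => θ ^ missed π i (t + 1))
      (fun π => θ ^ missed π i t) (1 + (θ - 1) * ε) ?_
    · refine key.trans ?_
      rw [pow_succ', mul_assoc]
      exact mul_le_mul_of_nonneg_left (ih (by omega))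
        (by have := mul_nonneg (sub_nonneg.2 hθ) hε; linarith)
    · intro π hπ
      rw [mem_goodProfiles] at hπ
      have hb : ∀ u ∈ window m t (m + 1 - n),
          θ ^ missed (swapAt i ⟨t, by omega⟩ u π) i (t + 1)
            ≤ θ ^ missed π i t * (1 + (θ - 1) * if π i u ∉ (reveal π i t).pool then 1 else 0) := by
        intro u hu
        rw [mem_window] at hu
        have h1 := missed_succ_le hπ hm (p := ⟨t, by omega⟩) hu.1 hu.2
        refine (pow_le_pow_right₀ hθ h1).trans (le_of_eq ?_)
        simp only
        split_ifs <;> simp [pow_succ]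
      refine (Finset.sum_le_sum hb).trans ?_
      rw [← Finset.mul_sum, Finset.sum_add_distrib, ← Finset.mul_sum, Finset.sum_boole,
        Finset.sum_const, card_window (by omega), nsmul_eq_mul, mul_one]
      -- The pool lies in the window and has at least `m - n * n - n * t` items, so at most `n * n +
      -- n * t` choices of `u` miss it.
      have h2 := card_window_filter_not (π i) (t := t) (M := m + 1 - n) (by omega)
        (reveal_pool_subset_itemsIn hπ hm t)
      have h3 := le_card_reveal_pool π i t
      have h4 : ((window m t (m + 1 - n)).filter fun u => π i u ∉ (reveal π i t).pool).card
          ≤ n * n + n * t := by omega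
      have h5 : (((window m t (m + 1 - n)).filter fun u => π i u ∉ (reveal π i t).pool).card : ℝ)
          ≤ ε * ((m + 1 - n : ℕ) - t) := by
        have htT : (t : ℝ) ≤ T := by exact_mod_cast (by omega : t ≤ T)
        have hn0 : (0 : ℝ) ≤ n := Nat.cast_nonneg n
        calc _ ≤ (n * n + n * t : ℝ) := by exact_mod_cast h4
          _ ≤ n * n + n * T := by gcongr
          _ ≤ ε * ((m + 1 - n : ℕ) - T) := hεT
          _ ≤ _ := by gcongr
      have hθ0 : 0 ≤ θ ^ missed π i t := by positivity
      rw [hcast]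
      calc _ ≤ θ ^ missed π i t * ((((m + 1 - n : ℕ) : ℝ) - t)
              + (θ - 1) * (ε * ((m + 1 - n : ℕ) - t))) := by
            gcongr
        _ = _ := by ring

/-! ### The supermartingale for the uninspected items of another agent -/

/-- If the inspected item is available, `j` gains `d ≤ 1` items, which are still uninspected. If it
belongs to `j`, one uninspected item is used up. If it belongs to anyone else, `d = 0`. -/
theorem uninspected_succ_spec (h : LastItemsAvailable π i) (hm : n ≤ m) (j : Fin n) (hj : j ≠ i)
    {p u : Fin m} (hpu : (p : ℕ) ≤ u) (hu : (u : ℕ) < m + 1 - n) :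
    (∃ d, uninspected π i j p + d = uninspected (swapAt i p u π) i j (p + 1) ∧
      ((reveal π i p).bundle j).card + d
        = ((reveal (swapAt i p u π) i (p + 1)).bundle j).card) ∨
    (π i u ∈ (reveal π i p).bundle j ∧
      uninspected π i j p = uninspected (swapAt i p u π) i j (p + 1) + 1 ∧
      ((reveal π i p).bundle j).card
        = ((reveal (swapAt i p u π) i (p + 1)).bundle j).card) := by
  unfold uninspected
  rw [reveal_succ_swapAt h hm hpu hu, itemsIn_succ_swapAt hpu hu]
  set s := reveal π i p with hs
  set W := itemsIn (π i) p (m + 1 - n) with hW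
  set g := π i u with hg
  have hv : s.Valid := reveal_valid π i p
  have hgW : g ∈ W := by rw [hW, mem_itemsIn, hg, Equiv.symm_apply_apply]; exact ⟨hpu, hu⟩
  by_cases hp : g ∈ s.pool
  · left
    have hgj : g ∉ s.bundle j := fun h => Finset.disjoint_left.1 (hv.disjoint_pool j) hp h
    have hbj : (s.assign i g).bundle j = s.bundle j := by simp [AllocState.assign, hj]
    have hW' : s.bundle j ∩ W.erase g = s.bundle j ∩ W := by
      ext x
      simp only [Finset.mem_inter, Finset.mem_erase]
      refine ⟨fun hx => ⟨hx.1, hx.2.2⟩, fun hx => ⟨hx.1, ?_, hx.2⟩⟩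
      rintro rfl; exact hgj hx.1
    rw [revealStep, if_pos hp]
    rcases (moves_otherPicks π i (s.assign i g)).bundle_eq_or_insert
      (List.nodup_cons.1 (nodup_agents i)).2 j with h1 | ⟨x, hx, h1⟩
    · refine ⟨0, ?_, ?_⟩
      · rw [h1, hbj, hW', add_zero]
      · rw [h1, hbj, add_zero]
    · have hxp : x ∈ s.pool.erase g := hx
      rw [Finset.mem_erase] at hxp
      have hxj : x ∉ s.bundle j := fun h => Finset.disjoint_left.1 (hv.disjoint_pool j) hxp.2 h
      have hxW : x ∈ W.erase g :=
        Finset.mem_erase.2 ⟨hxp.1, reveal_pool_subset_itemsIn h hm p hxp.2⟩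
      refine ⟨1, ?_, ?_⟩
      · rw [h1, hbj, Finset.insert_inter_of_mem hxW, Finset.card_insert_of_notMem, hW']
        exact fun h => hxj (Finset.mem_inter.1 h).1
      · rw [h1, hbj, Finset.card_insert_of_notMem hxj]
  · rw [revealStep_of_notMem hp, Finset.inter_erase]
    by_cases hgj : g ∈ s.bundle j
    · right
      refine ⟨hgj, ?_, rfl⟩
      rw [Finset.card_erase_add_one (Finset.mem_inter.2 ⟨hgj, hgW⟩)]
    · left
      refine ⟨0, ?_, rfl⟩
      rw [Finset.erase_eq_of_notMem, add_zero]
      exact fun h => hgj (Finset.mem_inter.1 h).1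

/-- The base of the supermartingale that controls the number of uninspected items at time `T`. -/
noncomputable def survivalBase (M T t : ℕ) : ℝ := 1 - ((M : ℝ) - T) / (2 * ((M : ℝ) - t))

/-- The base at `t` is the mean of a weight for an item placed uniformly in positions `t` to `M -
1`: `1 / 2` if it lands at `T` or later, `1` otherwise. The recursion conditions on whether it lands
in position `t`. -/
theorem survivalBase_succ {M T t : ℕ} (ht : t < T) (hT : T < M) :
    survivalBase M T t
      = survivalBase M T (t + 1) + (1 - survivalBase M T (t + 1)) / ((M : ℝ) - t) := by
  have h1 : (t : ℝ) + 1 ≤ T := by exact_mod_cast ht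
  have h2 : (T : ℝ) + 1 ≤ M := by exact_mod_cast hT
  have h3 : (M : ℝ) - t ≠ 0 := by linarith
  have h4 : (M : ℝ) - (t + 1) ≠ 0 := by linarith
  unfold survivalBase
  push_cast
  field_simp
  ring

theorem half_le_survivalBase {M T t : ℕ} (ht : t ≤ T) (hT : T < M) :
    1 / 2 ≤ survivalBase M T t := by
  have h1 : (t : ℝ) ≤ T := by exact_mod_cast ht
  have h2 : (T : ℝ) + 1 ≤ M := by exact_mod_cast hT
  have h3 : 0 < (M : ℝ) - t := by linarith
  unfold survivalBase
  have : ((M : ℝ) - T) / (2 * ((M : ℝ) - t)) ≤ 1 / 2 := by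
    rw [div_le_div_iff₀ (by linarith) (by norm_num)]; linarith
  linarith

theorem survivalBase_le_one {M T t : ℕ} (ht : t ≤ T) (hT : T < M) : survivalBase M T t ≤ 1 := by
  have h1 : (t : ℝ) ≤ T := by exact_mod_cast ht
  have h2 : (T : ℝ) + 1 ≤ M := by exact_mod_cast hT
  unfold survivalBase
  have : 0 ≤ ((M : ℝ) - T) / (2 * ((M : ℝ) - t)) := div_nonneg (by linarith) (by linarith)
  linarith

/-- An item that `j` gains later contributes the base of that time, which the factor `(survivalBase
M T 0)⁻¹` per item must compensate. -/
theorem survivalBase_le_zero {M T t : ℕ} (ht : t ≤ T) (hT : T < M) :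
    survivalBase M T t ≤ survivalBase M T 0 := by
  have h1 : (t : ℝ) ≤ T := by exact_mod_cast ht
  have h2 : (T : ℝ) + 1 ≤ M := by exact_mod_cast hT
  unfold survivalBase
  have : ((M : ℝ) - T) / (2 * ((M : ℝ) - (0 : ℕ))) ≤ ((M : ℝ) - T) / (2 * ((M : ℝ) - t)) := by
    apply div_le_div_of_nonneg_left <;> simp <;> linarith [(Nat.cast_nonneg t : (0 : ℝ) ≤ t)]
  linarith

/-- With `z` and `z'` the bases before and after a step and `z₀` the initial one, a gain of `d`
items costs `(z' / z₀) ^ d ≤ 1`. One of the `a` uninspected items of `j` is inspected with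
probability `a / (M - t)`, which contributes a factor `z'⁻¹`. -/
theorem sum_survival_le (hm : n ≤ m) (j : Fin n) (hj : j ≠ i) {T : ℕ} (hT : T < m + 1 - n)
    {t : ℕ} (ht : t ≤ T) :
    ∑ π ∈ goodProfiles n m i, survivalBase (m + 1 - n) T t ^ uninspected π i j t
        * (survivalBase (m + 1 - n) T 0)⁻¹ ^ ((reveal π i t).bundle j).card
      ≤ ∑ π ∈ goodProfiles n m i, survivalBase (m + 1 - n) T 0 ^ uninspected π i j 0
        * (survivalBase (m + 1 - n) T 0)⁻¹ ^ ((startState π i).bundle j).card := by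
  have hn := Fin.pos i
  induction t with
  | zero => exact le_rfl
  | succ t ih =>
    refine le_trans ?_ (ih (by omega))
    set M := m + 1 - n with hM
    set z := survivalBase M T t with hz
    set z' := survivalBase M T (t + 1) with hz'
    set z₀ := survivalBase M T 0 with hz₀
    have hz'half : 1 / 2 ≤ z' := half_le_survivalBase ht hT
    have hz'0 : 0 < z' := by linarith
    have hz00 : 0 < z₀ := by
      have : 1 / 2 ≤ z₀ := half_le_survivalBase (Nat.zero_le _) hT
      linarith
    have hz'1 : z' ≤ 1 := survivalBase_le_one ht hT
    have hzz₀ : z' ≤ z₀ := survivalBase_le_zero ht hT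
    have hrec : z = z' + (1 - z') / ((M : ℝ) - t) := survivalBase_succ (by omega) hT
    have htM : t < M := by omega
    have hcast : ((M - t : ℕ) : ℝ) = (M : ℝ) - t := by rw [Nat.cast_sub htM.le]
    have hMt : (0 : ℝ) < (M : ℝ) - t := by
      rw [← hcast]; exact_mod_cast Nat.sub_pos_of_lt htM
    have key := sum_le_of_swap_average (i := i) (M := M) (by omega)
      swapClosed_goodProfiles ⟨t, by omega⟩ htM
      (fun π => z' ^ uninspected π i j (t + 1)
        * z₀⁻¹ ^ ((reveal π i (t + 1)).bundle j).card)
      (fun π => z ^ uninspected π i j t * z₀⁻¹ ^ ((reveal π i t).bundle j).card) 1 ?_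
    · rwa [one_mul] at key
    · intro π hπ
      rw [mem_goodProfiles] at hπ
      set a := uninspected π i j t with ha
      set y := z₀⁻¹ ^ ((reveal π i t).bundle j).card with hy
      have hy0 : 0 ≤ y := by positivity
      have hb : ∀ u ∈ window m t M,
          z' ^ uninspected (swapAt i ⟨t, by omega⟩ u π) i j (t + 1)
              * z₀⁻¹ ^ ((reveal (swapAt i ⟨t, by omega⟩ u π) i (t + 1)).bundle j).card
            ≤ z' ^ a * y * (1 + (z'⁻¹ - 1) * if π i u ∈ (reveal π i t).bundle j then 1 else 0) := by
        intro u hu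
        rw [mem_window] at hu
        have hge : 0 ≤ (z'⁻¹ - 1) * if π i u ∈ (reveal π i t).bundle j then (1 : ℝ) else 0 := by
          refine mul_nonneg (sub_nonneg.2 ((one_le_inv₀ hz'0).2 hz'1)) ?_
          split_ifs <;> norm_num
        rcases uninspected_succ_spec hπ hm j hj (p := ⟨t, by omega⟩) hu.1 hu.2 with
          ⟨d, h1, h2⟩ | ⟨h0, h1, h2⟩
        · simp only at h1 h2
          rw [← h1, ← h2, pow_add, pow_add]
          have h3 : z' ^ d * z₀⁻¹ ^ d ≤ 1 := by
            rw [← mul_pow]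
            refine pow_le_one₀ (by positivity) ?_
            rw [← div_eq_mul_inv, div_le_one hz00]
            exact hzz₀
          calc z' ^ a * z' ^ d * (y * z₀⁻¹ ^ d) = z' ^ a * y * (z' ^ d * z₀⁻¹ ^ d) := by ring
            _ ≤ z' ^ a * y * 1 := by gcongr
            _ ≤ _ := by gcongr; linarith
        · simp only at h0 h1 h2
          rw [← h2, if_pos h0, ha, h1, pow_succ]
          apply le_of_eq
          field_simp
          ring
      refine (Finset.sum_le_sum hb).trans ?_
      rw [← Finset.mul_sum, Finset.sum_add_distrib, ← Finset.mul_sum, Finset.sum_boole,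
        Finset.sum_const, card_window (by omega), nsmul_eq_mul, mul_one, card_window_filter,
        hcast, one_mul]
      change z' ^ a * y * (((M : ℝ) - t) + (z'⁻¹ - 1) * (a : ℝ)) ≤ ((M : ℝ) - t) * (z ^ a * y)
      -- Bernoulli's inequality replaces the true mean factor, linear in `a`, by an `a`-th power;
      -- the recursion for the base says that this power turns `z'` into `z`.
      have hbern := one_add_mul_le_pow (a := (z'⁻¹ - 1) / ((M : ℝ) - t))
        (le_trans (by norm_num) (div_nonneg (sub_nonneg.2 ((one_le_inv₀ hz'0).2 hz'1)) hMt.le)) a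
      have hzz : z = z' * (1 + (z'⁻¹ - 1) / ((M : ℝ) - t)) := by
        rw [hrec]; field_simp
      calc z' ^ a * y * (((M : ℝ) - t) + (z'⁻¹ - 1) * (a : ℝ))
          = ((M : ℝ) - t) * (z' ^ a * y) * (1 + a * ((z'⁻¹ - 1) / ((M : ℝ) - t))) := by
            field_simp
        _ ≤ ((M : ℝ) - t) * (z' ^ a * y) * (1 + (z'⁻¹ - 1) / ((M : ℝ) - t)) ^ a := by gcongr
        _ = ((M : ℝ) - t) * (z ^ a * y) := by rw [hzz, mul_pow]; ring

end

/-! ### Counting the bad events -/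

section

variable {n m : ℕ} {i : Fin n}

theorem swapClosed_univ (i : Fin n) (M : ℕ) :
    SwapClosed i M (Finset.univ : Finset (Fin n → PrefOrder m)) :=
  fun _ _ _ _ _ _ => Finset.mem_univ _

theorem card_goodProfiles_le :
    ((goodProfiles n m i).card : ℝ) ≤ Fintype.card (Fin n → PrefOrder m) := by
  exact_mod_cast Finset.card_le_univ _

theorem card_le_sum_card {ι α : Type*} [DecidableEq α] {S : Finset ι} {A : Finset α}
    {B : ι → Finset α} (h : ∀ a ∈ A, ∃ x ∈ S, a ∈ B x) :
    (A.card : ℝ) ≤ ∑ x ∈ S, ((B x).card : ℝ) := by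
  have h1 : A ⊆ S.biUnion B := fun a ha => Finset.mem_biUnion.2 (h a ha)
  exact_mod_cast (Finset.card_le_card h1).trans Finset.card_biUnion_le

open Classical in
/-- The item in a given position is equally likely to be in any position below `M`. -/
theorem mul_card_filter_mem_le {M c : ℕ} (hM : M ≤ m) {D : Finset (Fin n → PrefOrder m)}
    (hD : SwapClosed i M D) (S : (Fin n → PrefOrder m) → Finset (Fin m))
    (hS : ∀ π ∈ D, ∀ u v : Fin m, (u : ℕ) < M → (v : ℕ) < M → S (swapAt i u v π) = S π)
    (hc : ∀ π ∈ D, (S π).card ≤ c) (p : Fin m) (hp : (p : ℕ) < M) :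
    (M : ℝ) * ((D.filter fun π => π i p ∈ S π).card : ℝ) ≤ c * D.card := by
  have h1 := sum_swap_average (t := 0) hM hD hp (fun π => if π i p ∈ S π then (1 : ℝ) else 0)
  rw [Nat.sub_zero, Finset.sum_boole] at h1
  rw [h1, mul_comm (c : ℝ), ← nsmul_eq_mul, ← Finset.sum_const]
  refine Finset.sum_le_sum fun π hπ => ?_
  have h2 : ∀ u ∈ window m 0 M, (if swapAt i p u π i p ∈ S (swapAt i p u π) then (1 : ℝ) else 0)
      = if π i u ∈ S π then 1 else 0 := by
    intro u hu
    rw [mem_window] at hu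
    rw [swapAt_apply_left, hS π hπ p u hp hu.2]
  rw [Finset.sum_congr rfl h2, Finset.sum_boole, card_window_filter]
  exact_mod_cast (Finset.card_le_card Finset.inter_subset_left).trans (hc π hπ)

open Classical in
-- The items gone before her turn, at most `n * n`, do not depend on her order, so each of the last
-- `n - 1` positions hits them with probability at most `n * n / m`.
theorem card_not_lastItemsAvailable_le (hm : n ≤ m) :
    (m : ℝ) * ((Finset.univ.filter fun π : Fin n → PrefOrder m => ¬ LastItemsAvailable π i).card : ℝ)
      ≤ n ^ 3 * Fintype.card (Fin n → PrefOrder m) := by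
  have hn := Fin.pos i
  set N := Fintype.card (Fin n → PrefOrder m) with hN
  set S : (Fin n → PrefOrder m) → Finset (Fin m) := fun π => (stateBeforeGiving π i).poolᶜ with hS
  have hc : ∀ π, (S π).card ≤ n * n := by
    intro π
    have h1 := (moves_stateBeforeGiving π i).card_pool_le
    rw [length_flatMap_recipients, length_agentsBefore] at h1
    have h3 : (initState n m).pool.card = m := by simp [initState]
    have h4 : (i : ℕ) * (n - 1) ≤ n * n := Nat.mul_le_mul i.2.le (Nat.sub_le _ _)
    simp only [hS, Finset.card_compl, Fintype.card_fin]
    omega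
  have h1 : ∀ p : Fin m, (m : ℝ) * ((Finset.univ.filter fun π => π i p ∈ S π).card : ℝ)
      ≤ (n * n : ℕ) * N := fun p =>
    mul_card_filter_mem_le le_rfl (swapClosed_univ i m) S
      (fun π _ u v _ _ => by simp only [hS]; rw [stateBeforeGiving_swapAt]) (fun π _ => hc π) p p.2
  have h2 : ((Finset.univ.filter fun π : Fin n → PrefOrder m => ¬ LastItemsAvailable π i).card : ℝ)
      ≤ ∑ p ∈ window m (m + 1 - n) m, ((Finset.univ.filter fun π => π i p ∈ S π).card : ℝ) := by
    refine card_le_sum_card fun π hπ => ?_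
    rw [Finset.mem_filter, LastItemsAvailable] at hπ
    push Not at hπ
    obtain ⟨k, hk, hk'⟩ := hπ.2
    exact ⟨k, mem_window.2 ⟨hk, k.2⟩, by simpa [hS] using hk'⟩
  calc _ ≤ (m : ℝ) * ∑ p ∈ window m (m + 1 - n) m,
        ((Finset.univ.filter fun π => π i p ∈ S π).card : ℝ) := by gcongr
    _ = ∑ p ∈ window m (m + 1 - n) m,
        (m : ℝ) * ((Finset.univ.filter fun π => π i p ∈ S π).card : ℝ) := Finset.mul_sum _ _ _
    _ ≤ ∑ _p ∈ window m (m + 1 - n) m, ((n * n : ℕ) : ℝ) * N := Finset.sum_le_sum fun p _ => h1 p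
    _ = ((m - (m + 1 - n) : ℕ) : ℝ) * ((n * n : ℕ) * N) := by
        rw [Finset.sum_const, card_window le_rfl, nsmul_eq_mul]
    _ ≤ (n : ℝ) * ((n * n : ℕ) * N) := by
        gcongr
        omega
    _ = _ := by push_cast; ring

open Classical in
-- Her gifts do not change when her first `m + 1 - n` positions are permuted, so each such position
-- holds a gift with probability at most `n / (m + 1 - n)`.
theorem card_exists_start_item_le (hm : n * n ≤ m) {t : ℕ} :
    ((m + 1 - n : ℕ) : ℝ) * (((goodProfiles n m i).filter fun π =>
        ∃ g ∈ (startState π i).bundle i, t ≤ ((π i).symm g : ℕ)).card : ℝ)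
      ≤ ((m + 1 - n - t : ℕ) : ℝ) * n * Fintype.card (Fin n → PrefOrder m) := by
  have hn := Fin.pos i
  have hnm : n ≤ m := (Nat.le_mul_of_pos_left n hn).trans hm
  have h1 : ∀ p : Fin m, (p : ℕ) < m + 1 - n → ((m + 1 - n : ℕ) : ℝ)
      * (((goodProfiles n m i).filter fun π => π i p ∈ (startState π i).bundle i).card : ℝ)
      ≤ (n : ℕ) * (goodProfiles n m i).card := fun p hp =>
    mul_card_filter_mem_le (by omega) swapClosed_goodProfiles (fun π => (startState π i).bundle i)
      (fun π hπ u v hu hv => by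
        rw [startState_swapAt (mem_goodProfiles.1 hπ) hnm hu hv])
      (fun π _ => card_startState_bundle_le π i hm i) p hp
  have h2 : (((goodProfiles n m i).filter fun π =>
        ∃ g ∈ (startState π i).bundle i, t ≤ ((π i).symm g : ℕ)).card : ℝ)
      ≤ ∑ p ∈ window m t (m + 1 - n),
        (((goodProfiles n m i).filter fun π => π i p ∈ (startState π i).bundle i).card : ℝ) := by
    refine card_le_sum_card fun π hπ => ?_
    rw [Finset.mem_filter] at hπ
    obtain ⟨hπ, g, hg, hgt⟩ := hπ
    refine ⟨(π i).symm g, mem_window.2 ⟨hgt,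
      lt_of_mem_startState_bundle (mem_goodProfiles.1 hπ) hnm hg⟩, ?_⟩
    rw [Finset.mem_filter]
    exact ⟨hπ, by simpa using hg⟩
  calc _ ≤ ((m + 1 - n : ℕ) : ℝ) * ∑ p ∈ window m t (m + 1 - n),
        (((goodProfiles n m i).filter fun π => π i p ∈ (startState π i).bundle i).card : ℝ) := by
        gcongr
    _ = ∑ p ∈ window m t (m + 1 - n), ((m + 1 - n : ℕ) : ℝ) *
        (((goodProfiles n m i).filter fun π => π i p ∈ (startState π i).bundle i).card : ℝ) :=
        Finset.mul_sum _ _ _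
    _ ≤ ∑ _p ∈ window m t (m + 1 - n), ((n : ℕ) : ℝ) * (goodProfiles n m i).card :=
        Finset.sum_le_sum fun p hp => h1 p (mem_window.1 hp).2
    _ = ((m + 1 - n - t : ℕ) : ℝ) * n * (goodProfiles n m i).card := by
        rw [Finset.sum_const, card_window (by omega), nsmul_eq_mul]; ring
    _ ≤ _ := by
        gcongr
        exact Finset.card_le_univ _

open Classical in
-- Plain Markov would not give a small bound; instead `2 ^ missed` is at least `1` plus the
-- indicator of a miss, and the main term `1` cancels against the moment bound `1 + 2 * ε * T`.
theorem card_missed_pos_le (hm : n ≤ m) {ε : ℝ} (hε : 0 ≤ ε) {T : ℕ} (hT : T ≤ m + 1 - n)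
    (hεT : (n * n + n * T : ℝ) ≤ ε * ((m + 1 - n : ℕ) - T)) (hεT' : ε * T ≤ 1) :
    (((goodProfiles n m i).filter fun π => 1 ≤ missed π i T).card : ℝ)
      ≤ 2 * ε * T * Fintype.card (Fin n → PrefOrder m) := by
  have h1 := sum_pow_missed_le (i := i) hm (θ := 2) (by norm_num) hε hT hεT le_rfl
  have h2 : ((goodProfiles n m i).card : ℝ)
        + (((goodProfiles n m i).filter fun π => 1 ≤ missed π i T).card : ℝ)
      ≤ ∑ π ∈ goodProfiles n m i, (2 : ℝ) ^ missed π i T := by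
    rw [← Finset.sum_boole, Finset.card_eq_sum_ones, Nat.cast_sum, ← Finset.sum_add_distrib]
    refine Finset.sum_le_sum fun π _ => ?_
    split_ifs with h
    · calc ((1 : ℕ) : ℝ) + 1 = 2 ^ 1 := by norm_num
        _ ≤ 2 ^ missed π i T := pow_le_pow_right₀ (by norm_num) h
    · have : (1 : ℝ) ≤ 2 ^ missed π i T := one_le_pow₀ (by norm_num)
      simpa using this
  have h3 : (1 + (2 - 1) * ε) ^ T ≤ 1 + 2 * ε * T := by
    have h4 : (1 + (2 - 1) * ε) ≤ Real.exp ε := by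
      have := Real.add_one_le_exp ε; linarith
    have h5 : (1 + (2 - 1) * ε) ^ T ≤ Real.exp (ε * T) := by
      rw [mul_comm ε (T : ℝ), Real.exp_nat_mul]
      exact pow_le_pow_left₀ (by linarith) h4 T
    have h6 : 0 ≤ ε * T := by positivity
    have h7 := Real.abs_exp_sub_one_le (x := ε * T) (by rwa [abs_of_nonneg h6])
    rw [abs_of_nonneg h6] at h7
    have h8 := le_abs_self (Real.exp (ε * T) - 1)
    linarith
  have h9 := mul_le_mul_of_nonneg_right h3 (Nat.cast_nonneg (α := ℝ) (goodProfiles n m i).card)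
  have h10 : 2 * ε * T * ((goodProfiles n m i).card : ℝ)
      ≤ 2 * ε * T * Fintype.card (Fin n → PrefOrder m) :=
    mul_le_mul_of_nonneg_left card_goodProfiles_le (by positivity)
  linarith

open Classical in
-- With `θ = 16` and `ε = 1 / 15` the moment at most doubles per step, while on the event it is at
-- least `4 ^ t`.
theorem card_missed_large_le (hm : n ≤ m) {T : ℕ} (hT : T ≤ m + 1 - n)
    (hεT : 15 * (n * n + n * T : ℝ) ≤ ((m + 1 - n : ℕ) - T : ℝ)) {t : ℕ} (ht : t ≤ T) :
    2 ^ t * (((goodProfiles n m i).filter fun π => t < 2 * missed π i t).card : ℝ)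
      ≤ Fintype.card (Fin n → PrefOrder m) := by
  have h1 := sum_pow_missed_le (i := i) hm (θ := 16) (ε := 1 / 15) (by norm_num) (by norm_num) hT
    (by linarith) ht
  have h2 : (4 : ℝ) ^ t * (((goodProfiles n m i).filter fun π => t < 2 * missed π i t).card : ℝ)
      ≤ ∑ π ∈ goodProfiles n m i, (16 : ℝ) ^ missed π i t := by
    rw [← Finset.sum_boole, Finset.mul_sum]
    refine Finset.sum_le_sum fun π _ => ?_
    split_ifs with h
    · rw [mul_one, show (16 : ℝ) = 4 ^ 2 by norm_num, ← pow_mul]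
      exact pow_le_pow_right₀ (by norm_num) h.le
    · rw [mul_zero]; positivity
  have h3 : (1 + (16 - 1) * (1 / 15) : ℝ) = 2 := by norm_num
  rw [h3] at h1
  have h4 : (4 : ℝ) ^ t = 2 ^ t * 2 ^ t := by rw [← mul_pow]; norm_num
  rw [h4, mul_assoc] at h2
  exact (le_of_mul_le_mul_left (h2.trans h1) (by positivity)).trans card_goodProfiles_le

open Classical in
-- At time `T` the base is `1 / 2` and `j` holds at least `κ` items, so on the event the
-- supermartingale is at least `2⁻ⁿ * z₀⁻¹ ^ κ`. Its initial mean is at most `2 ^ n`.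
theorem card_uninspected_small_le (hm : n * n ≤ m) (j : Fin n) (hj : j ≠ i) {T κ : ℕ}
    (hT : T < m + 1 - n) (hκ : n * (κ + 2) ≤ T) :
    (((goodProfiles n m i).filter fun π => uninspected π i j T ≤ n).card : ℝ)
      ≤ 4 ^ n * survivalBase (m + 1 - n) T 0 ^ κ * Fintype.card (Fin n → PrefOrder m) := by
  have hn := Fin.pos i
  have hnm : n ≤ m := (Nat.le_mul_of_pos_left n hn).trans hm
  have h1 := sum_survival_le (i := i) hnm j hj hT le_rfl
  set z₀ := survivalBase (m + 1 - n) T 0 with hz₀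
  have hhalf : 1 / 2 ≤ z₀ := half_le_survivalBase (Nat.zero_le _) hT
  have hpos : 0 < z₀ := by linarith
  have hle1 : z₀ ≤ 1 := survivalBase_le_one (Nat.zero_le _) hT
  have hinv1 : 1 ≤ z₀⁻¹ := (one_le_inv₀ hpos).2 hle1
  have hinv2 : z₀⁻¹ ≤ 2 := by
    rw [inv_le_comm₀ hpos (by norm_num)]; linarith
  have hzT : survivalBase (m + 1 - n) T T = 1 / 2 := by
    have : ((m + 1 - n : ℕ) : ℝ) - T ≠ 0 := by
      have : (T : ℝ) < (m + 1 - n : ℕ) := by exact_mod_cast hT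
      linarith
    unfold survivalBase
    field_simp
    norm_num
  rw [hzT] at h1
  have h2 : ∑ π ∈ goodProfiles n m i, z₀ ^ uninspected π i j 0
        * z₀⁻¹ ^ ((startState π i).bundle j).card ≤ (goodProfiles n m i).card * 2 ^ n := by
    rw [← nsmul_eq_mul, ← Finset.sum_const]
    refine Finset.sum_le_sum fun π _ => ?_
    calc _ ≤ 1 * z₀⁻¹ ^ ((startState π i).bundle j).card := by
          gcongr
          exact pow_le_one₀ hpos.le hle1
      _ ≤ z₀⁻¹ ^ n := by
          rw [one_mul]
          exact pow_le_pow_right₀ hinv1 (card_startState_bundle_le π i hm j)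
      _ ≤ 2 ^ n := by gcongr
  have h3 : (((goodProfiles n m i).filter fun π => uninspected π i j T ≤ n).card : ℝ)
        * ((1 / 2) ^ n * z₀⁻¹ ^ κ)
      ≤ ∑ π ∈ goodProfiles n m i, (1 / 2 : ℝ) ^ uninspected π i j T
        * z₀⁻¹ ^ ((reveal π i T).bundle j).card := by
    rw [← Finset.sum_boole, Finset.sum_mul]
    refine Finset.sum_le_sum fun π _ => ?_
    split_ifs with h
    · rw [one_mul]
      have h4 := le_mul_card_reveal_bundle π i hm j (t := T) (by omega)
      have h5 : κ ≤ ((reveal π i T).bundle j).card := by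
        have := Nat.le_of_mul_le_mul_left (hκ.trans h4) hn
        omega
      have h6 : (1 / 2 : ℝ) ^ n ≤ (1 / 2) ^ uninspected π i j T :=
        pow_le_pow_of_le_one (by norm_num) (by norm_num) h
      have h7 := pow_le_pow_right₀ hinv1 h5
      gcongr
    · rw [zero_mul]; positivity
  have h4 := (h3.trans h1).trans h2
  have h5 : (((goodProfiles n m i).filter fun π => uninspected π i j T ≤ n).card : ℝ)
      = ((((goodProfiles n m i).filter fun π => uninspected π i j T ≤ n).card : ℝ)
        * ((1 / 2) ^ n * z₀⁻¹ ^ κ)) * (2 ^ n * z₀ ^ κ) := by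
    have : ((1 / 2 : ℝ) ^ n * z₀⁻¹ ^ κ) * (2 ^ n * z₀ ^ κ) = 1 := by
      rw [inv_pow, one_div, inv_pow]; field_simp
    rw [mul_assoc, this, mul_one]
  rw [h5]
  calc _ ≤ ((goodProfiles n m i).card * 2 ^ n : ℝ) * (2 ^ n * z₀ ^ κ) := by gcongr
    _ = 4 ^ n * z₀ ^ κ * (goodProfiles n m i).card := by
        rw [show (4 : ℝ) = 2 * 2 by norm_num, mul_pow]; ring
    _ ≤ _ := by
        gcongr
        exact Finset.card_le_univ _

end

/-! ### Ranges of the threshold and numerical estimates -/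

section

variable {n m : ℕ} {i : Fin n}

theorem exists_threshold_of_not_sdPrefers {π : Fin n → PrefOrder m} (hm : n * n ≤ m) {q : ℕ}
    (hq : m = q * n) {j : Fin n}
    (h : ¬ SDPrefers (π i) (giveAwayRoundRobin π i) (giveAwayRoundRobin π j)) :
    ∃ t ≤ m, countBelow (π i) t (giveAwayRoundRobin π i)
      < countBelow (π i) t (giveAwayRoundRobin π j) := by
  by_contra hcon
  push Not at hcon
  exact h (sdPrefers_of_count _ (card_giveAwayRoundRobin π hm hq j i) fun t ht => hcon (t + 1) ht)

/-- The ways in which agent `i` can come to envy agent `j`, by the range of the threshold. -/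
theorem envy_cases {π : Fin n → PrefOrder m} (hm : n * n ≤ m) {q : ℕ} (hq : m = q * n)
    (h : LastItemsAvailable π i) {j : Fin n}
    (hsd : ¬ SDPrefers (π i) (giveAwayRoundRobin π i) (giveAwayRoundRobin π j)) {T₀ T₁ : ℕ}
    (hT₀ : T₀ ≤ m) :
    1 ≤ missed π i T₀ ∨ (∃ t, T₀ ≤ t ∧ t < T₁ ∧ t < 2 * missed π i t) ∨
    (∃ t, T₁ ≤ t ∧ t + T₁ ≤ m + 1 - n ∧ j ≠ i ∧ uninspected π i j t ≤ n) ∨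
    (∃ g ∈ (startState π i).bundle i, m + 1 - n - T₁ ≤ ((π i).symm g : ℕ)) := by
  obtain ⟨t, htm, ht⟩ := exists_threshold_of_not_sdPrefers hm hq hsd
  have hj : j ≠ i := by rintro rfl; exact lt_irrefl _ ht
  have htM : t < m + 1 - n := by
    by_contra hge
    have := no_envy_of_lt h hm hq j (not_lt.1 hge)
    omega
  have h1 := lt_two_mul_missed_of_envy hj htm ht
  have h2 := uninspected_lt_of_envy h hm hj htM.le ht
  have h3 := uninspected_self_le (π := π) (i := i) hm t
  rcases Nat.lt_or_ge t T₀ with h4 | h4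
  · left
    have := missed_mono (π := π) (i := i) h4.le hT₀
    omega
  right
  rcases Nat.lt_or_ge t T₁ with h5 | h5
  · exact Or.inl ⟨t, h4, h5, h1⟩
  right
  rcases Nat.lt_or_ge (m + 1 - n) (t + T₁) with h6 | h6
  · right
    -- Envy needs an uninspected item of `i`, hence a gift at position `t` or later, beyond `m + 1 -
    -- n - T₁`.
    have h7 : 0 < uninspected π i i t := by omega
    unfold uninspected at h7
    rw [Finset.card_pos] at h7
    obtain ⟨g, hg⟩ := h7
    rw [Finset.mem_inter, mem_itemsIn] at hg
    exact ⟨g, mem_startState_of_mem_reveal π i hg.1 hg.2.1, by omega⟩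
  · exact Or.inl ⟨t, h5, h6, hj, by omega⟩

theorem survivalBase_zero_pow_le {M T κ : ℕ} (hM : 0 < M) (hT : T ≤ M) :
    survivalBase M T 0 ^ κ ≤ Real.exp (-(κ * (((M : ℝ) - T) / (2 * M)))) := by
  have hM' : (0 : ℝ) < M := by exact_mod_cast hM
  have hT' : (T : ℝ) ≤ M := by exact_mod_cast hT
  have h1 : survivalBase M T 0 ≤ Real.exp (-(((M : ℝ) - T) / (2 * M))) := by
    have := Real.add_one_le_exp (-(((M : ℝ) - T) / (2 * M)))
    unfold survivalBase
    simp only [Nat.cast_zero, sub_zero]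
    linarith
  have h0 : 0 ≤ survivalBase M T 0 := by
    unfold survivalBase
    simp only [Nat.cast_zero, sub_zero]
    rw [sub_nonneg, div_le_one (by linarith)]
    have := Nat.cast_nonneg (α := ℝ) T
    linarith
  rw [← mul_neg, Real.exp_nat_mul]
  exact pow_le_pow_left₀ h0 h1 κ

/-- In the middle range of thresholds the survival bound is at most `(4 ^ l)⁻¹ ^ 4`. -/
theorem survivalBase_zero_pow_le_of_middle (hn : 0 < n) {M T l : ℕ} (hl : 1 ≤ l)
    (h1 : 64 * n * l ≤ T) (h2 : T + 64 * n * l ≤ M) :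
    survivalBase M T 0 ^ (T / n - 2) ≤ 1 / ((4 : ℝ) ^ l) ^ 4 := by
  have hM : 0 < M := by
    have : 0 < 64 * n * l := by positivity
    omega
  refine (survivalBase_zero_pow_le hM (by omega)).trans ?_
  have hn' : (0 : ℝ) < n := by exact_mod_cast hn
  have hM' : (0 : ℝ) < M := by exact_mod_cast hM
  have hl' : (1 : ℝ) ≤ l := by exact_mod_cast hl
  have h1' : 64 * (n : ℝ) * l ≤ T := by exact_mod_cast h1
  have h2' : (T : ℝ) + 64 * n * l ≤ M := by exact_mod_cast h2
  have hdiv : (T : ℝ) / (2 * n) ≤ ((T / n - 2 : ℕ) : ℝ) := by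
    have h3 : T < n * (T / n) + n := by
      have := Nat.div_add_mod T n
      have := Nat.mod_lt T hn
      omega
    have h4 : 6 ≤ T / n := by
      rw [Nat.le_div_iff_mul_le hn]
      nlinarith
    have h3' : (T : ℝ) < n * ((T / n : ℕ) : ℝ) + n := by exact_mod_cast h3
    rw [Nat.cast_sub (by omega), div_le_iff₀ (by positivity)]
    push_cast
    nlinarith
  -- One of `T` and `M - T` is at least `M / 2` and the other at least `64 * n * l`. The constant
  -- `64` is chosen to make the exponent below at least `8 * l`.
  have hprod : 32 * (n : ℝ) * l * M ≤ (M - T) * T := by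
    rcases le_total ((M : ℝ) / 2) T with h | h
    · have := mul_le_mul (show 64 * (n : ℝ) * l ≤ M - T by linarith) h (by positivity)
        (by nlinarith)
      linarith
    · have := mul_le_mul (show (M : ℝ) / 2 ≤ M - T by linarith) h1' (by positivity) (by linarith)
      linarith
  have hexp : 8 * (l : ℝ) ≤ ((T / n - 2 : ℕ) : ℝ) * (((M : ℝ) - T) / (2 * M)) := by
    have hnn : 0 ≤ ((M : ℝ) - T) / (2 * M) := div_nonneg (by nlinarith) (by positivity)
    refine le_trans ?_ (mul_le_mul_of_nonneg_right hdiv hnn)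
    rw [div_mul_div_comm, le_div_iff₀ (by positivity)]
    nlinarith
  calc Real.exp (-(((T / n - 2 : ℕ) : ℝ) * (((M : ℝ) - T) / (2 * M))))
      ≤ Real.exp (-(((8 * l : ℕ) : ℝ) * 1)) := by
        apply Real.exp_le_exp.2
        push_cast
        linarith
    _ = 1 / Real.exp 1 ^ (8 * l) := by
        rw [Real.exp_neg, Real.exp_nat_mul, one_div]
    _ ≤ 1 / 2 ^ (8 * l) := by
        apply one_div_le_one_div_of_le (by positivity)
        refine pow_le_pow_left₀ (by norm_num) ?_ _
        have := Real.add_one_le_exp (1 : ℝ)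
        linarith
    _ = 1 / ((4 : ℝ) ^ l) ^ 4 := by
        rw [show (4 : ℝ) = 2 ^ 2 by norm_num, ← pow_mul, ← pow_mul]
        congr 2
        ring

/-- Consequences of the assumption that `m` is large. -/
theorem size_bounds (hn : 2 ≤ n) {l : ℕ} (hnl : n ≤ l) (hm : 1000 * n ^ 3 * l ^ 2 ≤ m) :
    (2 : ℝ) ≤ n ∧ (n : ℝ) ≤ l ∧ 2000 * (n : ℝ) ^ 2 * l ^ 2 ≤ m ∧ 4000 * (n : ℝ) ^ 2 * l ≤ m ∧
      n * n ≤ m ∧ n ≤ m ∧ 64 * n * l ≤ m + 1 - n ∧ (2 * n * l : ℝ) ≤ n ^ 2 * l ∧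
      (n : ℝ) * n ≤ n * l := by
  have hn' : (2 : ℝ) ≤ n := by exact_mod_cast hn
  have hl' : (2 : ℝ) ≤ l := by exact_mod_cast hn.trans hnl
  have hnl' : (n : ℝ) ≤ l := by exact_mod_cast hnl
  have hm' : 1000 * (n : ℝ) ^ 3 * l ^ 2 ≤ m := by exact_mod_cast hm
  have hbig : 2000 * (n : ℝ) ^ 2 * l ^ 2 ≤ m := by
    refine le_trans ?_ hm'
    have : 0 ≤ (n : ℝ) ^ 2 * l ^ 2 := by positivity
    nlinarith
  have hbig2 : 4000 * (n : ℝ) ^ 2 * l ≤ m := by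
    refine le_trans ?_ hbig
    have : 0 ≤ (n : ℝ) ^ 2 * l := by positivity
    nlinarith
  have hbigN : 4000 * n ^ 2 * l ≤ m := by exact_mod_cast hbig2
  have h1 : n * l ≤ n ^ 2 * l := by
    rw [pow_two]; exact Nat.mul_le_mul_right l (Nat.le_mul_self n)
  have h2 : n * n ≤ n * l := Nat.mul_le_mul_left n hnl
  have h3 : n ≤ n * n := Nat.le_mul_self n
  have h4 : 64 * n * l = 64 * (n * l) := by ring
  have h5 : 4000 * n ^ 2 * l = 4000 * (n ^ 2 * l) := by ring
  refine ⟨hn', hnl', hbig, hbig2, by omega, by omega, by omega, ?_, by exact_mod_cast h2⟩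
  have : 0 ≤ (n : ℝ) * l := by positivity
  nlinarith

open Classical in
theorem card_missed_first_le (hn : 2 ≤ n) {l : ℕ} (hnl : n ≤ l) (hm : 1000 * n ^ 3 * l ^ 2 ≤ m) :
    (m : ℝ) * (((goodProfiles n m i).filter fun π => 1 ≤ missed π i (6 * l)).card : ℝ)
      ≤ 168 * n * l ^ 2 * Fintype.card (Fin n → PrefOrder m) := by
  obtain ⟨hn', hl', hbig, hbig2, hnnm, hnm, h64, hnl2, hnn2⟩ := size_bounds hn hnl hm
  have hm0 : (0 : ℝ) < m := by
    have h1 : (0 : ℝ) < n := by linarith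
    have h2 : (0 : ℝ) < l := by linarith
    exact lt_of_lt_of_le (by positivity) hbig
  have hMm : (m : ℝ) ≤ ((m + 1 - n : ℕ) : ℝ) + n := by
    exact_mod_cast (by omega : m ≤ m + 1 - n + n)
  have hn0 : (0 : ℝ) ≤ n := Nat.cast_nonneg n
  have hl0 : (0 : ℝ) ≤ l := Nat.cast_nonneg l
  have hln : (l : ℝ) ≤ n * l := by nlinarith
  -- Here `ε = 14 * n * l / m`, since the numerator is at most `7 * n * l` and the number of
  -- remaining positions at least `m / 2`.
  have hε : (n * n + n * (6 * l : ℕ) : ℝ) ≤ (14 * n * l / m) * ((m + 1 - n : ℕ) - (6 * l : ℕ)) := by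
    have h1 : (m : ℝ) / 2 ≤ ((m + 1 - n : ℕ) : ℝ) - (6 * l : ℕ) := by
      push_cast
      linarith
    calc (n * n + n * (6 * l : ℕ) : ℝ) ≤ 7 * n * l := by push_cast; linarith
      _ = (14 * n * l / m) * (m / 2) := by field_simp; ring
      _ ≤ _ := by gcongr
  have hε' : (14 * n * l / m : ℝ) * (6 * l : ℕ) ≤ 1 := by
    push_cast
    rw [div_mul_eq_mul_div, div_le_one hm0]
    refine le_trans ?_ hbig
    have : 0 ≤ (n : ℝ) * l ^ 2 := by positivity
    nlinarith
  have h6 : 6 * l ≤ 64 * n * l := Nat.mul_le_mul_right l (by omega)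
  have h1 := card_missed_pos_le (i := i) hnm (by positivity) (h6.trans h64) hε hε'
  calc (m : ℝ) * (((goodProfiles n m i).filter fun π => 1 ≤ missed π i (6 * l)).card : ℝ)
      ≤ m * (2 * (14 * n * l / m) * (6 * l : ℕ) * Fintype.card (Fin n → PrefOrder m)) := by gcongr
    _ = 168 * n * l ^ 2 * Fintype.card (Fin n → PrefOrder m) := by
      push_cast; field_simp; ring

open Classical in
theorem sum_card_missed_large_le (hn : 2 ≤ n) {l : ℕ} (hnl : n ≤ l) (hm : 1000 * n ^ 3 * l ^ 2 ≤ m) (hml : m * 2 ^ n ≤ 4 ^ l) :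
    (m : ℝ) * ∑ t ∈ Finset.Ico (6 * l) (64 * n * l),
        (((goodProfiles n m i).filter fun π => t < 2 * missed π i t).card : ℝ)
      ≤ Fintype.card (Fin n → PrefOrder m) := by
  obtain ⟨hn', hl', hbig, hbig2, hnnm, hnm, h64, hnl2, hnn2⟩ := size_bounds hn hnl hm
  have hm0 : (0 : ℝ) < m := by
    have h1 : (0 : ℝ) < n := by linarith
    have h2 : (0 : ℝ) < l := by linarith
    exact lt_of_lt_of_le (by positivity) hbig
  have hMm : (m : ℝ) ≤ ((m + 1 - n : ℕ) : ℝ) + n := by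
    exact_mod_cast (by omega : m ≤ m + 1 - n + n)
  set N := (Fintype.card (Fin n → PrefOrder m) : ℝ) with hN
  have hN0 : 0 ≤ N := Nat.cast_nonneg _
  have hML : (m : ℝ) ≤ (4 : ℝ) ^ l := by
    exact_mod_cast (Nat.le_mul_of_pos_right m (by positivity)).trans hml
  have hlarge : 15 * (n * n + n * (64 * n * l : ℕ) : ℝ)
      ≤ ((m + 1 - n : ℕ) - (64 * n * l : ℕ) : ℝ) := by
    push_cast
    have : (n : ℝ) ≤ n * n := by nlinarith
    linarith
  have h1 : ∀ t ∈ Finset.Ico (6 * l) (64 * n * l), (((goodProfiles n m i).filter fun π => t < 2 * missed π i t).card : ℝ) ≤ N / m ^ 3 := by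
    intro t ht
    rw [Finset.mem_Ico] at ht
    have h2 := card_missed_large_le (i := i) hnm h64 hlarge ht.2.le
    -- The range starts at `6 * l` so that `2 ^ t ≥ (4 ^ l) ^ 3`; one power of `m` is then spent on
    -- the sum over `t`.
    have h3 : (m : ℝ) ^ 3 ≤ 2 ^ t := by
      calc (m : ℝ) ^ 3 ≤ (4 ^ l) ^ 3 := by gcongr
        _ = 2 ^ (6 * l) := by
          rw [show (4 : ℝ) = 2 ^ 2 by norm_num, ← pow_mul, ← pow_mul]
          congr 1
          ring
        _ ≤ 2 ^ t := pow_le_pow_right₀ (by norm_num) ht.1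
    rw [le_div_iff₀ (by positivity), mul_comm]
    exact (mul_le_mul_of_nonneg_right h3 (Nat.cast_nonneg _)).trans h2
  have h2 := Finset.sum_le_sum h1
  rw [Finset.sum_const, Nat.card_Ico, nsmul_eq_mul] at h2
  have h3 : (((64 * n * l) - (6 * l) : ℕ) : ℝ) ≤ m := by
    exact_mod_cast (Nat.sub_le _ _).trans (h64.trans (by omega))
  have h4 : (1 : ℝ) ≤ m := by exact_mod_cast (by omega : 1 ≤ m)
  calc (m : ℝ) * ∑ t ∈ Finset.Ico (6 * l) (64 * n * l), (((goodProfiles n m i).filter fun π => t < 2 * missed π i t).card : ℝ)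
      ≤ m * (m * (N / m ^ 3)) := by
        gcongr
        exact h2.trans (by gcongr)
    _ = N / m := by field_simp
    _ ≤ N := div_le_self hN0 h4

open Classical in
theorem sum_card_uninspected_small_le (hn : 2 ≤ n) {l : ℕ} (hnl : n ≤ l) (hm : 1000 * n ^ 3 * l ^ 2 ≤ m) (hml : m * 2 ^ n ≤ 4 ^ l) :
    (m : ℝ) * ∑ x ∈ (Finset.univ.erase i) ×ˢ (Finset.Icc (64 * n * l) (m + 1 - n - 64 * n * l)),
        (((goodProfiles n m i).filter fun π => uninspected π i x.1 x.2 ≤ n).card : ℝ)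
      ≤ Fintype.card (Fin n → PrefOrder m) := by
  obtain ⟨hn', hl', hbig, hbig2, hnnm, hnm, h64, hnl2, hnn2⟩ := size_bounds hn hnl hm
  have hm0 : (0 : ℝ) < m := by
    have h1 : (0 : ℝ) < n := by linarith
    have h2 : (0 : ℝ) < l := by linarith
    exact lt_of_lt_of_le (by positivity) hbig
  set N := (Fintype.card (Fin n → PrefOrder m) : ℝ) with hN
  have hN0 : 0 ≤ N := Nat.cast_nonneg _
  have hl : 0 < l := by omega
  have hT₁pos : 0 < 64 * n * l := by positivity
  have h1 : ∀ x ∈ (Finset.univ.erase i) ×ˢ (Finset.Icc (64 * n * l) (m + 1 - n - 64 * n * l)),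
      (((goodProfiles n m i).filter fun π => uninspected π i x.1 x.2 ≤ n).card : ℝ) ≤ N / m ^ 4 := by
    rintro ⟨j, t⟩ hx
    rw [Finset.mem_product, Finset.mem_erase, Finset.mem_Icc] at hx
    obtain ⟨⟨hj, -⟩, ht1, ht2⟩ := hx
    simp only at hj ht1 ht2
    have h2T : 2 ≤ t / n := by
      rw [Nat.le_div_iff_mul_le (by omega)]
      nlinarith
    have h2 := card_uninspected_small_le (i := i) hnnm j hj (T := t) (κ := t / n - 2)
      (by omega) (by rw [Nat.sub_add_cancel h2T]; exact Nat.mul_div_le t n)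
    have h3 := survivalBase_zero_pow_le_of_middle (n := n) (by omega) (M := m + 1 - n) (T := t) (l := l)
      (by omega) ht1 (by omega)
    have h4 : 1 / ((4 : ℝ) ^ l) ^ 4 ≤ 1 / (m * 2 ^ n) ^ 4 := by
      apply one_div_le_one_div_of_le (by positivity)
      gcongr
      exact_mod_cast hml
    -- The factor `2 ^ n` in `hml` is there to absorb this `4 ^ n`. What is left, `m ^ 4`, beats the
    -- at most `m * m` pairs and the outer factor `m`.
    have h5 : (4 : ℝ) ^ n * (1 / (m * 2 ^ n) ^ 4) ≤ 1 / m ^ 4 := by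
      rw [mul_pow, mul_one_div, div_le_div_iff₀ (by positivity) (by positivity), one_mul, mul_comm]
      refine mul_le_mul_of_nonneg_left ?_ (by positivity)
      rw [show (4 : ℝ) = 2 ^ 2 by norm_num, ← pow_mul, ← pow_mul]
      exact pow_le_pow_right₀ (by norm_num) (by omega)
    calc (((goodProfiles n m i).filter fun π => uninspected π i j t ≤ n).card : ℝ) ≤ 4 ^ n * survivalBase (m + 1 - n) t 0 ^ (t / n - 2) * N := h2
      _ ≤ 4 ^ n * (1 / (m * 2 ^ n) ^ 4) * N := by
        gcongr
        exact h3.trans h4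
      _ ≤ 1 / m ^ 4 * N := by gcongr
      _ = N / m ^ 4 := by ring
  have h2 := Finset.sum_le_sum h1
  rw [Finset.sum_const, Finset.card_product, nsmul_eq_mul] at h2
  have h3 : (((Finset.univ.erase i).card * (Finset.Icc (64 * n * l) (m + 1 - n - 64 * n * l)).card : ℕ) : ℝ)
      ≤ m * m := by
    have h4 : (Finset.univ.erase i).card ≤ m :=
      ((Finset.card_le_univ _).trans (by simp)).trans hnm
    have h5 : (Finset.Icc (64 * n * l) (m + 1 - n - 64 * n * l)).card ≤ m := by
      rw [Nat.card_Icc]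
      omega
    exact_mod_cast Nat.mul_le_mul h4 h5
  have h4 : (1 : ℝ) ≤ m := by exact_mod_cast (by omega : 1 ≤ m)
  calc (m : ℝ) * ∑ x ∈ (Finset.univ.erase i) ×ˢ (Finset.Icc (64 * n * l) (m + 1 - n - 64 * n * l)), (((goodProfiles n m i).filter fun π => uninspected π i x.1 x.2 ≤ n).card : ℝ)
      ≤ m * (m * m * (N / m ^ 4)) := by
        gcongr
        exact h2.trans (by gcongr)
    _ = N / m := by field_simp
    _ ≤ N := div_le_self hN0 h4

open Classical in
theorem card_late_start_item_le (hn : 2 ≤ n) {l : ℕ} (hnl : n ≤ l) (hm : 1000 * n ^ 3 * l ^ 2 ≤ m) :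
    (m : ℝ) * (((goodProfiles n m i).filter fun π => ∃ g ∈ (startState π i).bundle i,
        m + 1 - n - 64 * n * l ≤ ((π i).symm g : ℕ)).card : ℝ)
      ≤ 128 * n ^ 2 * l * Fintype.card (Fin n → PrefOrder m) := by
  obtain ⟨hn', hl', hbig, hbig2, hnnm, hnm, h64, hnl2, hnn2⟩ := size_bounds hn hnl hm
  have hm0 : (0 : ℝ) < m := by
    have h1 : (0 : ℝ) < n := by linarith
    have h2 : (0 : ℝ) < l := by linarith
    exact lt_of_lt_of_le (by positivity) hbig
  have hMm : (m : ℝ) ≤ ((m + 1 - n : ℕ) : ℝ) + n := by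
    exact_mod_cast (by omega : m ≤ m + 1 - n + n)
  have h1 := card_exists_start_item_le (i := i) hnnm (t := m + 1 - n - 64 * n * l)
  rw [Nat.sub_sub_self h64] at h1
  have h2 : (m : ℝ) ≤ 2 * (m + 1 - n : ℕ) := by
    have : (n : ℝ) ≤ n * n := by nlinarith
    linarith
  refine (mul_le_mul_of_nonneg_right h2 (Nat.cast_nonneg _)).trans ?_
  rw [mul_assoc]
  refine (mul_le_mul_of_nonneg_left h1 (by norm_num)).trans (le_of_eq ?_)
  push_cast
  ring

open Classical in
theorem card_envious_le_add (hm : n * n ≤ m) {q : ℕ} (hq : m = q * n) {T₀ T₁ : ℕ} (hT₀ : T₀ ≤ m)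
    (hT₁ : T₁ ≤ m + 1 - n) :
    ((Finset.univ.filter fun π : Fin n → PrefOrder m =>
      ∃ j, ¬ SDPrefers (π i) (giveAwayRoundRobin π i) (giveAwayRoundRobin π j)).card : ℝ)
      ≤ (Finset.univ.filter fun π : Fin n → PrefOrder m => ¬ LastItemsAvailable π i).card
        + (((goodProfiles n m i).filter fun π => 1 ≤ missed π i T₀).card
        + (∑ t ∈ Finset.Ico T₀ T₁,
            (((goodProfiles n m i).filter fun π => t < 2 * missed π i t).card : ℝ)
        + (∑ x ∈ (Finset.univ.erase i) ×ˢ (Finset.Icc T₁ (m + 1 - n - T₁)),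
            (((goodProfiles n m i).filter fun π => uninspected π i x.1 x.2 ≤ n).card : ℝ)
        + ((goodProfiles n m i).filter fun π =>
            ∃ g ∈ (startState π i).bundle i, m + 1 - n - T₁ ≤ ((π i).symm g : ℕ)).card))) := by
  generalize hF₀ : (Finset.univ.filter fun π : Fin n → PrefOrder m => ¬ LastItemsAvailable π i) = F₀
  generalize hF₁ : ((goodProfiles n m i).filter fun π => 1 ≤ missed π i T₀) = F₁
  generalize hF₄ : ((goodProfiles n m i).filter fun π =>
    ∃ g ∈ (startState π i).bundle i, m + 1 - n - T₁ ≤ ((π i).symm g : ℕ)) = F₄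
  have hcover : (Finset.univ.filter fun π : Fin n → PrefOrder m =>
      ∃ j, ¬ SDPrefers (π i) (giveAwayRoundRobin π i) (giveAwayRoundRobin π j))
      ⊆ F₀ ∪ (F₁ ∪ ((Finset.Ico T₀ T₁).biUnion (fun t =>
          (goodProfiles n m i).filter fun π => t < 2 * missed π i t) ∪
        (((Finset.univ.erase i) ×ˢ (Finset.Icc T₁ (m + 1 - n - T₁))).biUnion (fun x =>
          (goodProfiles n m i).filter fun π => uninspected π i x.1 x.2 ≤ n) ∪ F₄))) := by
    subst hF₀ hF₁ hF₄
    intro π hπ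
    obtain ⟨j, hj⟩ := (Finset.mem_filter.1 hπ).2
    by_cases hg : LastItemsAvailable π i
    · have hg' := mem_goodProfiles.2 hg
      simp only [Finset.mem_union, Finset.mem_biUnion]
      right
      rcases envy_cases hm hq hg hj (T₀ := T₀) (T₁ := T₁) hT₀ with
        h | ⟨t, h1, h2, h3⟩ | ⟨t, h1, h2, h3, h4⟩ | h
      · exact Or.inl (Finset.mem_filter.2 ⟨hg', h⟩)
      · exact Or.inr (Or.inl ⟨t, Finset.mem_Ico.2 ⟨h1, h2⟩, Finset.mem_filter.2 ⟨hg', h3⟩⟩)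
      · refine Or.inr (Or.inr (Or.inl ⟨(j, t), ?_, Finset.mem_filter.2 ⟨hg', h4⟩⟩))
        rw [Finset.mem_product, Finset.mem_erase, Finset.mem_Icc]
        exact ⟨⟨h3, Finset.mem_univ _⟩, h1, by simp only; omega⟩
      · exact Or.inr (Or.inr (Or.inr (Finset.mem_filter.2 ⟨hg', h⟩)))
    · exact Finset.mem_union_left _ (Finset.mem_filter.2 ⟨Finset.mem_univ _, hg⟩)
  refine le_trans (Nat.cast_le.2 ((Finset.card_le_card hcover).trans
    ((Finset.card_union_le _ _).trans (Nat.add_le_add_left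
    ((Finset.card_union_le _ _).trans (Nat.add_le_add_left
    ((Finset.card_union_le _ _).trans (Nat.add_le_add Finset.card_biUnion_le
    ((Finset.card_union_le _ _).trans (Nat.add_le_add_right Finset.card_biUnion_le _)))) _)) _)))) ?_
  push_cast
  exact le_rfl

open Classical in
theorem card_envious_le (hn : 2 ≤ n) {q l : ℕ} (hq : m = q * n) (hnl : n ≤ l)
    (hml : m * 2 ^ n ≤ 4 ^ l) (hm : 1000 * n ^ 3 * l ^ 2 ≤ m) :
    (m : ℝ) * ((Finset.univ.filter fun π : Fin n → PrefOrder m =>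
      ∃ j, ¬ SDPrefers (π i) (giveAwayRoundRobin π i) (giveAwayRoundRobin π j)).card : ℝ)
      ≤ 1000 * n ^ 2 * l ^ 2 * Fintype.card (Fin n → PrefOrder m) := by
  obtain ⟨hn', hl', hbig, hbig2, hnnm, hnm, h64, hnl2, hnn2⟩ := size_bounds hn hnl hm
  have hm0 : (0 : ℝ) < m := by
    have h1 : (0 : ℝ) < n := by linarith
    have h2 : (0 : ℝ) < l := by linarith
    exact lt_of_lt_of_le (by positivity) hbig
  set N := (Fintype.card (Fin n → PrefOrder m) : ℝ) with hN
  have hN0 : 0 ≤ N := Nat.cast_nonneg _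
  have hl2 : (2 : ℝ) ≤ l := hn'.trans hl'
  have h6 : 6 * l ≤ 64 * n * l := Nat.mul_le_mul_right l (by omega)
  have hcard := card_envious_le_add (i := i) hnnm hq (T₀ := 6 * l) (T₁ := 64 * n * l)
    (by omega) h64
  have b₀ := card_not_lastItemsAvailable_le (i := i) hnm
  have b₁ := card_missed_first_le (i := i) hn hnl hm
  have b₂ := sum_card_missed_large_le (i := i) hn hnl hm hml
  have b₃ := sum_card_uninspected_small_le (i := i) hn hnl hm hml
  have b₄ := card_late_start_item_le (i := i) hn hnl hm
  rw [← hN] at b₀ b₁ b₂ b₃ b₄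
  have hsum : (m : ℝ) * ((Finset.univ.filter fun π : Fin n → PrefOrder m =>
      ∃ j, ¬ SDPrefers (π i) (giveAwayRoundRobin π i) (giveAwayRoundRobin π j)).card : ℝ)
      ≤ (n ^ 3 + 168 * n * l ^ 2 + 2 + 128 * n ^ 2 * l) * N := by
    have := mul_le_mul_of_nonneg_left hcard hm0.le
    linarith
  refine hsum.trans (mul_le_mul_of_nonneg_right ?_ hN0)
  have e1 : (n : ℝ) ^ 3 ≤ n ^ 2 * l ^ 2 := by
    have : (n : ℝ) ≤ l ^ 2 := by nlinarith
    calc (n : ℝ) ^ 3 = n ^ 2 * n := by ring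
      _ ≤ _ := by gcongr
  have e2 : (n : ℝ) * l ^ 2 ≤ n ^ 2 * l ^ 2 := by
    gcongr; nlinarith
  have e3 : (1 : ℝ) ≤ n ^ 2 * l ^ 2 := by
    have h1 : (1 : ℝ) ≤ n ^ 2 := by nlinarith
    have h2 : (1 : ℝ) ≤ l ^ 2 := by nlinarith
    nlinarith
  have e4 : (n : ℝ) ^ 2 * l ≤ n ^ 2 * l ^ 2 := by
    gcongr; nlinarith
  linarith

end

/-! ### Union bound over the agents and the choice of `l` -/

open Classical in
theorem one_sub_le_giveAwaySuccessProb {n m q l : ℕ} (hn : 2 ≤ n) (hq1 : 1 ≤ q) (hq : m = q * n)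
    (hnl : n ≤ l) (hml : m * 2 ^ n ≤ 4 ^ l) :
    1 - 1000 * (n : ℝ) ^ 3 * l ^ 2 / m ≤ giveAwaySuccessProb n m := by
  have hm0 : (0 : ℝ) < m := by
    have : 0 < m := by rw [hq]; positivity
    exact_mod_cast this
  rcases le_or_gt (1000 * n ^ 3 * l ^ 2) m with hm | hm
  · set N := Fintype.card (Fin n → PrefOrder m) with hN
    have hN0 : (0 : ℝ) < N := by
      have : 0 < N := Fintype.card_pos
      exact_mod_cast this
    rw [giveAwaySuccessProb, uniformProfileLaw_real]
    set G := Finset.univ.filter fun π : Fin n → PrefOrder m =>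
      π ∈ {π | IsAllocation (giveAwayRoundRobin π) ∧ IsSDEF π (giveAwayRoundRobin π)} with hG
    set B : Fin n → Finset (Fin n → PrefOrder m) := fun i => Finset.univ.filter fun π =>
      ∃ j, ¬ SDPrefers (π i) (giveAwayRoundRobin π i) (giveAwayRoundRobin π j) with hB
    have h1 : (Finset.univ : Finset (Fin n → PrefOrder m)) ⊆ G ∪ Finset.univ.biUnion B := by
      intro π _
      rw [Finset.mem_union, Finset.mem_biUnion]
      by_cases h : ∃ i j, ¬ SDPrefers (π i) (giveAwayRoundRobin π i) (giveAwayRoundRobin π j)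
      · obtain ⟨i, hi⟩ := h
        exact Or.inr ⟨i, Finset.mem_univ _, Finset.mem_filter.2 ⟨Finset.mem_univ _, hi⟩⟩
      · left
        push Not at h
        exact Finset.mem_filter.2 ⟨Finset.mem_univ _,
          isAllocation_giveAwayRoundRobin π ⟨0, by omega⟩, h⟩
    have h2 : (N : ℝ) ≤ G.card + ∑ i, ((B i).card : ℝ) := by
      have h3 := (Finset.card_le_card h1).trans ((Finset.card_union_le _ _).trans
        (Nat.add_le_add_left Finset.card_biUnion_le _))
      rw [Finset.card_univ] at h3
      exact_mod_cast h3
    have h3 : ∀ i ∈ (Finset.univ : Finset (Fin n)),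
        ((B i).card : ℝ) ≤ 1000 * n ^ 2 * l ^ 2 * N / m := by
      intro i _
      rw [le_div_iff₀ hm0, mul_comm]
      exact card_envious_le hn hq hnl hml hm
    have h4 := Finset.sum_le_sum h3
    rw [Finset.sum_const, Finset.card_univ, Fintype.card_fin, nsmul_eq_mul] at h4
    rw [le_div_iff₀ hN0]
    have h5 : (1 - 1000 * (n : ℝ) ^ 3 * l ^ 2 / m) * N
        = N - n * (1000 * n ^ 2 * l ^ 2 * N / m) := by
      field_simp
    have h6 : (1 - 1000 * (n : ℝ) ^ 3 * l ^ 2 / m) * N ≤ G.card := by linarith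
    refine h6.trans (le_of_eq ?_)
    rw [hG]
    congr!
  -- For small `m` the claimed lower bound is not positive.
  · have h1 : (1 : ℝ) ≤ 1000 * (n : ℝ) ^ 3 * l ^ 2 / m := by
      rw [le_div_iff₀ hm0, one_mul]
      exact_mod_cast hm.le
    have h2 : 0 ≤ giveAwaySuccessProb n m := measureReal_nonneg
    linarith

theorem one_sub_log_le_giveAwaySuccessProb {n m q : ℕ} (hn : 2 ≤ n) (hq1 : 1 ≤ q)
    (hq : m = q * n) :
    1 - (67584 * (n : ℝ) ^ 3 * Real.log (m : ℝ) ^ 2 + 25216 * (n : ℝ) ^ 4 * Real.log (m : ℝ)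
            + 2354 * (n : ℝ) ^ 5 + 128 * (n : ℝ) ^ 2 * Real.log (m : ℝ) + 24 * (n : ℝ) ^ 3
            + 3 * (n : ℝ) ^ 2 + (n : ℝ)) / (m : ℝ) ≤ giveAwaySuccessProb n m := by
  have hm1 : 1 ≤ m := by rw [hq]; exact Nat.mul_pos hq1 (by omega)
  have hm0 : (0 : ℝ) < m := by exact_mod_cast hm1
  set L := Real.log (m : ℝ) with hL
  have hL0 : 0 ≤ L := Real.log_natCast_nonneg m
  -- The first summand gives `m ≤ 4 ^ ⌈L⌉₊`, the second absorbs `2 ^ n` and ensures `n ≤ l`.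
  set l := ⌈L⌉₊ + n with hl
  have hn' : (2 : ℝ) ≤ n := by exact_mod_cast hn
  have hml : m * 2 ^ n ≤ 4 ^ l := by
    have h1 : (m : ℝ) ≤ 4 ^ ⌈L⌉₊ := by
      calc (m : ℝ) = Real.exp L := (Real.exp_log hm0).symm
        _ ≤ Real.exp (⌈L⌉₊ * 1) := Real.exp_le_exp.2 (by rw [mul_one]; exact Nat.le_ceil L)
        _ = Real.exp 1 ^ ⌈L⌉₊ := Real.exp_nat_mul _ _
        _ ≤ 4 ^ ⌈L⌉₊ := by
          refine pow_le_pow_left₀ (Real.exp_pos _).le ?_ _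
          have := Real.exp_one_lt_d9
          linarith
    have h2 : m ≤ 4 ^ ⌈L⌉₊ := by exact_mod_cast h1
    rw [hl, pow_add]
    exact Nat.mul_le_mul h2 (Nat.pow_le_pow_left (by norm_num) n)
  refine le_trans ?_ (one_sub_le_giveAwaySuccessProb hn hq1 hq (by omega) hml)
  -- The `1` lost by rounding up is at most `n / 2`.
  have hlle : (l : ℝ) ≤ L + 3 / 2 * n := by
    have := Nat.ceil_lt_add_one hL0
    rw [hl]; push_cast; linarith
  have h1 : (l : ℝ) ^ 2 ≤ (L + 3 / 2 * n) ^ 2 := by gcongr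
  -- These three coefficients are below those of the target; its remaining terms are nonnegative
  -- slack.
  have h2 : 1000 * (n : ℝ) ^ 3 * l ^ 2
      ≤ 1000 * (n : ℝ) ^ 3 * L ^ 2 + 3000 * (n : ℝ) ^ 4 * L + 2250 * (n : ℝ) ^ 5 := by
    calc 1000 * (n : ℝ) ^ 3 * l ^ 2 ≤ 1000 * (n : ℝ) ^ 3 * (L + 3 / 2 * n) ^ 2 := by gcongr
      _ = _ := by ring
  have h3 : 0 ≤ (n : ℝ) ^ 3 * L ^ 2 := by positivity
  have h4 : 0 ≤ (n : ℝ) ^ 4 * L := by positivity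
  have h5 : 0 ≤ (n : ℝ) ^ 5 := by positivity
  have h6 : 0 ≤ (n : ℝ) ^ 2 * L := by positivity
  have h7 : 0 ≤ (n : ℝ) ^ 3 := by positivity
  have h8 : 0 ≤ (n : ℝ) ^ 2 := by positivity
  have h9 : 1000 * (n : ℝ) ^ 3 * l ^ 2 / m
      ≤ (67584 * (n : ℝ) ^ 3 * L ^ 2 + 25216 * (n : ℝ) ^ 4 * L
            + 2354 * (n : ℝ) ^ 5 + 128 * (n : ℝ) ^ 2 * L + 24 * (n : ℝ) ^ 3
            + 3 * (n : ℝ) ^ 2 + (n : ℝ)) / (m : ℝ) := by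
    gcongr
    linarith
  linarith

theorem theorem5 (n : ℕ) (hn : 2 ≤ n) :
    (∃ C : ℝ, ∃ k : ℕ, ∀ m q : ℕ, 1 ≤ q → m = q * n →
      1 - C * Real.log (m : ℝ) ^ k / (m : ℝ) ≤ giveAwaySuccessProb n m) ∧
    (∀ m q : ℕ, 1 ≤ q → m = q * n →
      1 - (67584 * (n : ℝ) ^ 3 * Real.log (m : ℝ) ^ 2 + 25216 * (n : ℝ) ^ 4 * Real.log (m : ℝ)
            + 2354 * (n : ℝ) ^ 5 + 128 * (n : ℝ) ^ 2 * Real.log (m : ℝ) + 24 * (n : ℝ) ^ 3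
            + 3 * (n : ℝ) ^ 2 + (n : ℝ)) / (m : ℝ) ≤ giveAwaySuccessProb n m) := by
  -- As `m ≥ 2`, `log m ≥ 1 / 2`. Hence `log m ≤ 2 * log m ^ 2` and `1 ≤ 4 * log m ^ 2`, which gives
  -- the weights `2` and `4`.
  refine ⟨⟨67584 * (n : ℝ) ^ 3 + 2 * (25216 * (n : ℝ) ^ 4 + 128 * (n : ℝ) ^ 2)
    + 4 * (2354 * (n : ℝ) ^ 5 + 24 * (n : ℝ) ^ 3 + 3 * (n : ℝ) ^ 2 + n), 2,
    fun m q hq1 hq => ?_⟩, fun m q hq1 hq => one_sub_log_le_giveAwaySuccessProb hn hq1 hq⟩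
  refine le_trans ?_ (one_sub_log_le_giveAwaySuccessProb hn hq1 hq)
  have hm2 : 2 ≤ m := by
    rw [hq]
    exact hn.trans (Nat.le_mul_of_pos_left n hq1)
  have hlog : 1 / 2 ≤ Real.log (m : ℝ) := by
    have h1 : Real.log 2 ≤ Real.log (m : ℝ) :=
      Real.log_le_log (by norm_num) (by exact_mod_cast hm2)
    have := Real.log_two_gt_d9
    linarith
  set L := Real.log (m : ℝ) with hL
  have h1 : 1 ≤ 4 * L ^ 2 := by nlinarith
  have h2 : L ≤ 2 * L ^ 2 := by nlinarith
  have a1 : 0 ≤ 25216 * (n : ℝ) ^ 4 + 128 * (n : ℝ) ^ 2 := by positivity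
  have a2 : 0 ≤ 2354 * (n : ℝ) ^ 5 + 24 * (n : ℝ) ^ 3 + 3 * (n : ℝ) ^ 2 + n := by positivity
  have b1 := mul_le_mul_of_nonneg_left h2 a1
  have b2 := mul_le_mul_of_nonneg_left h1 a2
  refine sub_le_sub_left ?_ 1
  gcongr
  linarith
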